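/- Let $(M,g)$ be a time-oriented globally hyperbolic Lorentzian spacetime of dimension $d+1$, i.e. it is strongly causal and all causal diamonds $J^+(x)\cap J^-(y)$ are compact. Two points are called \emph{spacelike separated} if they are distinct and no causal curve connects them, and \emph{null separated} if they are distinct and connected by a causal curve but by no timelike curve. \textbf{(1)} If $\psi:M\to M$ is a diffeomorphism that preserves spacelike separation, in the sense that $x,y$ are spacelike separated if and only if $\psi(x),\psi(y)$ are, then $g$ and its pullback under $\psi$ are related by a Weyl factor: there is a smooth $\Omega:M\to(0,\infty)$ with $g_{\psi(p)}(d\psi\,v,d\psi\,w)=\Omega(p)^2\,g_p(v,w)$ for all $p\in M$ and $v,w\in T_pM$. Let now $\phi$ be a real scalar quantum field on $M$ with Hilbert space $\mathcal H$: it assigns to each smearing function $f\in C_c^\infty(M,\mathbb R)$ an unbounded Hermitian operator $\phi[f]$, linearly in $f$, and there is a dense subspace of $\mathcal H$ contained in the domain of every product $\phi[f_1]\cdots\phi[f_n]$. Assume - microcausality: $[\phi[f],\phi[h]]=0$ whenever the supports of $f$ and $h$ are spacelike separated; - non-commutation at null separation: whenever $x,y$ are null separated and $O_1\ni x$, $O_2\ni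 y$ are open, there are smearing functions $f,h$ supported in $O_1,O_2$ respectively with $[\phi[f],\phi[h]]\neq0$. Let $A\subseteq M$ be open (for instance $A=M$), let $\psi_t$ $(t\in\mathbb R)$ be a smooth one-parameter group of diffeomorphisms of $A$, and let $U(t)=e^{-iKt}$ be a strongly continuous one-parameter unitary group on $\mathcal H$ that acts geometrically on the fields in $A$, implementing $\psi_t$: for every $t$ and every smearing function $f$ supported in $A$ there is a smearing function $\tilde f$ with $U(t)^\dagger\phi[f]U(t)=\phi[\tilde f]$ and $\operatorname{supp}\tilde f=\psi_t(\operatorname{supp}f)$. \textbf{(2)} Then each $\psi_t$ preserves spacelike separation ($x,y\in A$ are spacelike separated in $M$ if and only if $\psi_t(x),\psi_t(y)$ are), and each $\psi_t$ is conformal: there is a smooth $\Omega_t:A\to(0,\infty)$ such that the pullback of $g$ under $\psi_t$ is $\Omega_t^2\,g$ on $A$. If $\psi_t$ is generated by the vector field $\xi^a$, then $\xi^a$ is a conformal Killing vector field on $A$: it is smooth and $\nabla_a\xi_b+\nabla_b\xi_a=\kappa\,g_{ab}$ for a smooth function $\kappa$ on $A$. \textbf{(3)} In particular, let $\mathcal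 A$ be the von Neumann algebra generated by the fields in $A$, let $\Psi\in\mathcal H$ be cyclic and separating for $\mathcal A$, and let $U(t)=e^{-iK_\Psi t}$ be the modular flow of $\Psi$ with respect to $\mathcal A$ (the unitary group that fixes $\Psi$, preserves $\mathcal A$ and its commutant, and satisfies the KMS condition). If this modular flow acts geometrically on the fields in $A$, implementing the flow $\psi_t$ generated by $\xi^a$, then each $\psi_t$ is conformal on $A$ and $\xi^a$ is a conformal Killing vector field on $A$. -/

import Mathlib

open Set Manifold Bundle
open scoped ContDiff Topology InnerProductSpace

noncomputable section

/-! ### Spacetimes -/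

/-- A time-oriented Lorentzian metric, signature `(-,+,…,+)`, on a smooth manifold `M` of dimension
`d + 1`.  The time orientation is given by a smooth timelike vector field, declared future-directed. -/
structure Spacetime (d : ℕ) (M : Type*) [TopologicalSpace M]
    [ChartedSpace (EuclideanSpace ℝ (Fin (d + 1))) M] [IsManifold (𝓡 (d + 1)) ∞ M] where
  /-- The metric tensor. -/
  metric : ∀ p : M, TangentSpace (𝓡 (d + 1)) p →L[ℝ] TangentSpace (𝓡 (d + 1)) p →L[ℝ] ℝ
  symm : ∀ p v w, metric p v w = metric p w v
  /-- Every tangent space has an orthonormal basis with exactly one timelike vector. -/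
  lorentzian : ∀ p, ∃ b : Module.Basis (Fin (d + 1)) ℝ (TangentSpace (𝓡 (d + 1)) p),
    ∀ i j, metric p (b i) (b j) = if i = j then (if i = 0 then -1 else 1) else 0
  smooth_metric : ContMDiff (𝓡 (d + 1))
    ((𝓡 (d + 1)).prod 𝓘(ℝ, EuclideanSpace ℝ (Fin (d + 1)) →L[ℝ]
      EuclideanSpace ℝ (Fin (d + 1)) →L[ℝ] ℝ)) ∞
    (fun p ↦ TotalSpace.mk' (EuclideanSpace ℝ (Fin (d + 1)) →L[ℝ]
      EuclideanSpace ℝ (Fin (d + 1)) →L[ℝ] ℝ)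
      (E := fun q : M ↦ TangentSpace (𝓡 (d + 1)) q →L[ℝ] TangentSpace (𝓡 (d + 1)) q →L[ℝ] ℝ)
      p (metric p))
  /-- The vector field fixing the time orientation. -/
  time : ∀ p : M, TangentSpace (𝓡 (d + 1)) p
  smooth_time : ContMDiff (𝓡 (d + 1)) (𝓡 (d + 1)).tangent ∞
    (fun p ↦ (⟨p, time p⟩ : TangentBundle (𝓡 (d + 1)) M))
  time_timelike : ∀ p, metric p (time p) (time p) < 0

namespace Spacetime

variable {d : ℕ} {M : Type*} [TopologicalSpace M]
  [ChartedSpace (EuclideanSpace ℝ (Fin (d + 1))) M] [IsManifold (𝓡 (d + 1)) ∞ M]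

/-- Future-directed causal (timelike or null, nonzero) tangent vectors. -/
def FutureCausal (S : Spacetime d M) (p : M) (v : TangentSpace (𝓡 (d + 1)) p) : Prop :=
  S.metric p v v ≤ 0 ∧ S.metric p v (S.time p) < 0

/-- Future-directed timelike tangent vectors. -/
def FutureTimelike (S : Spacetime d M) (p : M) (v : TangentSpace (𝓡 (d + 1)) p) : Prop :=
  S.metric p v v < 0 ∧ S.metric p v (S.time p) < 0

/-- There is a `C¹` future-directed causal curve from `x` to `y`. -/
def CausalStep (S : Spacetime d M) (x y : M) : Prop :=
  ∃ γ : ℝ → M, ContMDiffOn 𝓘(ℝ, ℝ) (𝓡 (d + 1)) 1 γ (Icc 0 1) ∧ γ 0 = x ∧ γ 1 = y ∧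
    ∀ t ∈ Icc (0 : ℝ) 1,
      S.FutureCausal (γ t) (mfderivWithin 𝓘(ℝ, ℝ) (𝓡 (d + 1)) γ (Icc 0 1) t (1 : ℝ))

/-- There is a `C¹` future-directed timelike curve from `x` to `y`. -/
def TimelikeStep (S : Spacetime d M) (x y : M) : Prop :=
  ∃ γ : ℝ → M, ContMDiffOn 𝓘(ℝ, ℝ) (𝓡 (d + 1)) 1 γ (Icc 0 1) ∧ γ 0 = x ∧ γ 1 = y ∧
    ∀ t ∈ Icc (0 : ℝ) 1,
      S.FutureTimelike (γ t) (mfderivWithin 𝓘(ℝ, ℝ) (𝓡 (d + 1)) γ (Icc 0 1) t (1 : ℝ))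

/-- `y` lies in the causal future `J⁺(x)`: either `y = x`, or there is a piecewise `C¹`
future-directed causal curve from `x` to `y`. -/
def CausalLE (S : Spacetime d M) : M → M → Prop := Relation.ReflTransGen S.CausalStep

/-- `y` lies in the chronological future `I⁺(x)`: there is a piecewise `C¹` future-directed
timelike curve from `x` to `y`. -/
def ChronLT (S : Spacetime d M) : M → M → Prop := Relation.TransGen S.TimelikeStep

/-- Two points are spacelike separated if they are distinct and no causal curve connects them. -/
def SpacelikeSeparated (S : Spacetime d M) (x y : M) : Prop :=
  ¬ S.CausalLE x y ∧ ¬ S.CausalLE y x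

/-- Two distinct points are null separated if a causal curve but no timelike curve connects them. -/
def NullSeparated (S : Spacetime d M) (x y : M) : Prop :=
  x ≠ y ∧ (S.CausalLE x y ∨ S.CausalLE y x) ∧ ¬ S.ChronLT x y ∧ ¬ S.ChronLT y x

/-- Strong causality: every neighbourhood `U` of a point contains a neighbourhood `V` of it such
that every causal curve with endpoints in `V` stays in `U`. -/
def StronglyCausal (S : Spacetime d M) : Prop :=
  ∀ p : M, ∀ U ∈ 𝓝 p, ∃ V ∈ 𝓝 p, V ⊆ U ∧
    ∀ x ∈ V, ∀ y ∈ V, ∀ z, S.CausalLE x z → S.CausalLE z y → z ∈ U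

/-- Global hyperbolicity: strong causality and compactness of all causal diamonds
`J⁺(x) ∩ J⁻(y)`. -/
def GloballyHyperbolic (S : Spacetime d M) : Prop :=
  S.StronglyCausal ∧ ∀ x y, IsCompact {z | S.CausalLE x z ∧ S.CausalLE z y}

/-- The map `ψ`, near the points of the open set `A`, pulls the metric back to `Ω²` times itself,
for a smooth positive function `Ω` on `A`. -/
def ConformalOn (S : Spacetime d M) (A : Set M) (ψ : M → M) : Prop :=
  ∃ Ω : M → ℝ, ContMDiffOn (𝓡 (d + 1)) 𝓘(ℝ, ℝ) ∞ Ω A ∧ ∀ p ∈ A, 0 < Ω p ∧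
    ∀ v w : TangentSpace (𝓡 (d + 1)) p,
      S.metric (ψ p) (mfderiv (𝓡 (d + 1)) (𝓡 (d + 1)) ψ p v)
        (mfderiv (𝓡 (d + 1)) (𝓡 (d + 1)) ψ p w) = Ω p ^ 2 * S.metric p v w

/-- The components of the metric in the chart at `p`, as a function of the coordinates `y`. -/
def metricInChart (S : Spacetime d M) (p : M) (y : EuclideanSpace ℝ (Fin (d + 1))) :
    EuclideanSpace ℝ (Fin (d + 1)) →L[ℝ] EuclideanSpace ℝ (Fin (d + 1)) →L[ℝ] ℝ :=
  let D : EuclideanSpace ℝ (Fin (d + 1)) →L[ℝ] EuclideanSpace ℝ (Fin (d + 1)) :=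
    mfderiv 𝓘(ℝ, EuclideanSpace ℝ (Fin (d + 1))) (𝓡 (d + 1)) (extChartAt (𝓡 (d + 1)) p).symm y
  let g : EuclideanSpace ℝ (Fin (d + 1)) →L[ℝ] EuclideanSpace ℝ (Fin (d + 1)) →L[ℝ] ℝ :=
    S.metric ((extChartAt (𝓡 (d + 1)) p).symm y)
  g.bilinearComp D D

/-- The components of a vector field in the chart at `p`, as a function of the coordinates `y`. -/
def vectorInChart (ξ : ∀ q : M, TangentSpace (𝓡 (d + 1)) q) (p : M)
    (y : EuclideanSpace ℝ (Fin (d + 1))) : EuclideanSpace ℝ (Fin (d + 1)) :=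
  mfderiv (𝓡 (d + 1)) 𝓘(ℝ, EuclideanSpace ℝ (Fin (d + 1))) (extChartAt (𝓡 (d + 1)) p)
    ((extChartAt (𝓡 (d + 1)) p).symm y) (ξ ((extChartAt (𝓡 (d + 1)) p).symm y))

/-- The Levi-Civita covariant derivative `v^a w^b ∇_a ξ_b` at `p`, computed in the chart at `p`
(whose coordinate space is, by construction, the tangent space at `p`):
`g(∂_v ξ, w) + Γ(w; v, ξ)`, with the Christoffel symbols of the first kind
`Γ(w; v, u) = ½ (∂_v g(u, w) + ∂_u g(v, w) - ∂_w g(v, u))`. -/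
def covDeriv (S : Spacetime d M) (ξ : ∀ q : M, TangentSpace (𝓡 (d + 1)) q) (p : M)
    (v w : TangentSpace (𝓡 (d + 1)) p) : ℝ :=
  let y₀ : EuclideanSpace ℝ (Fin (d + 1)) := extChartAt (𝓡 (d + 1)) p p
  let g := S.metricInChart p
  let X := vectorInChart ξ p
  let v' : EuclideanSpace ℝ (Fin (d + 1)) := v
  let w' : EuclideanSpace ℝ (Fin (d + 1)) := w
  g y₀ (fderiv ℝ X y₀ v') w' +
    (1 / 2) * (fderiv ℝ g y₀ v' (X y₀) w' + fderiv ℝ g y₀ (X y₀) v' w'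
      - fderiv ℝ g y₀ w' v' (X y₀))

/-- `ξ` is a conformal Killing vector field on the open set `A`: it is smooth there and
`∇_a ξ_b + ∇_b ξ_a = κ g_ab` for a smooth function `κ` on `A`. -/
def ConformalKillingOn (S : Spacetime d M) (A : Set M)
    (ξ : ∀ q : M, TangentSpace (𝓡 (d + 1)) q) : Prop :=
  ContMDiffOn (𝓡 (d + 1)) (𝓡 (d + 1)).tangent ∞
    (fun p ↦ (⟨p, ξ p⟩ : TangentBundle (𝓡 (d + 1)) M)) A ∧
  ∃ κ : M → ℝ, ContMDiffOn (𝓡 (d + 1)) 𝓘(ℝ, ℝ) ∞ κ A ∧ ∀ p ∈ A,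
    ∀ v w : TangentSpace (𝓡 (d + 1)) p,
      S.covDeriv ξ p v w + S.covDeriv ξ p w v = κ p * S.metric p v w

end Spacetime

/-- `ψ` restricts to a (smooth) one-parameter group of diffeomorphisms of the open set `A`.
Its values off `A` play no role. -/
structure IsFlowOn (d : ℕ) {M : Type*} [TopologicalSpace M]
    [ChartedSpace (EuclideanSpace ℝ (Fin (d + 1))) M] (A : Set M) (ψ : ℝ → M → M) : Prop where
  smooth : ContMDiffOn (𝓘(ℝ, ℝ).prod (𝓡 (d + 1))) (𝓡 (d + 1)) ∞
    (fun z : ℝ × M ↦ ψ z.1 z.2) (univ ×ˢ A)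
  mapsTo : ∀ t, MapsTo (ψ t) A A
  zero : ∀ p ∈ A, ψ 0 p = p
  add : ∀ s t, ∀ p ∈ A, ψ (s + t) p = ψ s (ψ t p)

/-! ### Quantum fields -/

/-- Smearing functions: smooth, compactly supported, real-valued functions on `M`. -/
def SmearingFunction (d : ℕ) (M : Type*) [TopologicalSpace M]
    [ChartedSpace (EuclideanSpace ℝ (Fin (d + 1))) M] :
    Submodule ℝ C^∞⟮𝓡 (d + 1), M; 𝓘(ℝ, ℝ), ℝ⟯ where
  carrier := {f | HasCompactSupport (f : M → ℝ)}
  zero_mem' := by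
    simpa using (HasCompactSupport.zero : HasCompactSupport (0 : M → ℝ))
  add_mem' := by
    intro f g hf hg
    simpa using HasCompactSupport.add hf hg
  smul_mem' := by
    intro c f hf
    have h : HasCompactSupport ((fun _ : M ↦ c) • (f : M → ℝ)) := HasCompactSupport.smul_left hf
    exact h

/-- The support of a smearing function. -/
def smearingSupport {d : ℕ} {M : Type*} [TopologicalSpace M]
    [ChartedSpace (EuclideanSpace ℝ (Fin (d + 1))) M] (f : SmearingFunction d M) : Set M :=
  tsupport (f.1 : M → ℝ)

/-- A real scalar quantum field on `M` with Hilbert space `H`: to each smearing function `f` it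
associates an unbounded Hermitian operator `φ[f]`, real-linearly in `f`.  The dense subspace `dom`
is contained in the domain of every product `φ[f₁] ⋯ φ[fₙ]`; this is expressed by the equivalent
requirement that it be a common invariant domain (the intersection of the domains of all
products is a common invariant domain). -/
structure ScalarField (d : ℕ) (M : Type*) [TopologicalSpace M]
    [ChartedSpace (EuclideanSpace ℝ (Fin (d + 1))) M]
    (H : Type*) [NormedAddCommGroup H] [InnerProductSpace ℂ H] where
  /-- The smeared field operators. -/
  op : SmearingFunction d M → H →ₗ.[ℂ] H
  /-- The common domain. -/
  dom : Submodule ℂ H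
  dense_dom : Dense (dom : Set H)
  dom_le : ∀ f, dom ≤ (op f).domain
  op_mem : ∀ f (v : H) (hv : v ∈ dom), op f ⟨v, dom_le f hv⟩ ∈ dom
  hermitian : ∀ f, (op f).IsFormalAdjoint (op f)
  op_add : ∀ f g (v : H) (hv : v ∈ dom),
    op (f + g) ⟨v, dom_le _ hv⟩ = op f ⟨v, dom_le f hv⟩ + op g ⟨v, dom_le g hv⟩
  op_smul : ∀ (c : ℝ) f (v : H) (hv : v ∈ dom),
    op (c • f) ⟨v, dom_le _ hv⟩ = (c : ℂ) • op f ⟨v, dom_le f hv⟩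

/-- `U† T U = T'` as unbounded operators, domains included. -/
def ConjugatesTo {H : Type*} [NormedAddCommGroup H] [InnerProductSpace ℂ H] [CompleteSpace H]
    (U : unitary (H →L[ℂ] H)) (T T' : H →ₗ.[ℂ] H) : Prop :=
  ∃ hdom : ∀ v, v ∈ T'.domain ↔ (U : H →L[ℂ] H) v ∈ T.domain,
    ∀ (v : H) (hv : v ∈ T'.domain),
      T' ⟨v, hv⟩ = (star (U : H →L[ℂ] H)) (T ⟨(U : H →L[ℂ] H) v, (hdom v).1 hv⟩)

/-- The bounded operator `B` satisfies `B T ⊆ T B`. -/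
def CommutesWithUnbounded {H : Type*} [NormedAddCommGroup H] [InnerProductSpace ℂ H]
    (B : H →L[ℂ] H) (T : H →ₗ.[ℂ] H) : Prop :=
  ∀ v : T.domain, ∃ h : B v ∈ T.domain, T ⟨B v, h⟩ = B (T v)

namespace ScalarField

variable {d : ℕ} {M : Type*} [TopologicalSpace M]
  [ChartedSpace (EuclideanSpace ℝ (Fin (d + 1))) M] [IsManifold (𝓡 (d + 1)) ∞ M]
  {H : Type*} [NormedAddCommGroup H] [InnerProductSpace ℂ H] [CompleteSpace H]

/-- `[φ[f], φ[g]] = 0`, as an operator on the common domain. -/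
def FieldsCommute (φ : ScalarField d M H) (f g : SmearingFunction d M) : Prop :=
  ∀ (v : H) (hv : v ∈ φ.dom),
    φ.op f ⟨φ.op g ⟨v, φ.dom_le g hv⟩, φ.dom_le f (φ.op_mem g v hv)⟩ =
      φ.op g ⟨φ.op f ⟨v, φ.dom_le f hv⟩, φ.dom_le g (φ.op_mem f v hv)⟩

/-- Field operators whose smearing functions have spacelike separated supports commute. -/
def Microcausality (φ : ScalarField d M H) (S : Spacetime d M) : Prop :=
  ∀ f g : SmearingFunction d M, (∀ x ∈ smearingSupport f, ∀ y ∈ smearingSupport g, S.SpacelikeSeparated x y) →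
    φ.FieldsCommute f g

/-- Fields do not commute at null separation: given open regions containing a pair of
null-separated points, there are smearing functions supported in them whose field operators do
not commute. -/
def NullNoncommutation (φ : ScalarField d M H) (S : Spacetime d M) : Prop :=
  ∀ x y : M, S.NullSeparated x y → ∀ O₁ O₂ : Set M, IsOpen O₁ → IsOpen O₂ → x ∈ O₁ → y ∈ O₂ →
    ∃ f g : SmearingFunction d M, smearingSupport f ⊆ O₁ ∧ smearingSupport g ⊆ O₂ ∧ ¬ φ.FieldsCommute f g

/-- The unitary `U` acts geometrically on the fields in the region `A`, implementing `ψ`: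
for `f` supported in `A`, `U† φ[f] U` is a field operator `φ[f']` with `supp f' = ψ(supp f)`. -/
def ActsGeometricallyOn (φ : ScalarField d M H) (U : unitary (H →L[ℂ] H)) (A : Set M)
    (ψ : M → M) : Prop :=
  ∀ f : SmearingFunction d M, smearingSupport f ⊆ A → ∃ f' : SmearingFunction d M,
    ConjugatesTo U (φ.op f) (φ.op f') ∧ smearingSupport f' = ψ '' (smearingSupport f)

/-- The von Neumann algebra generated by the fields in the region `A`: the commutant of the set of
all bounded `B` such that `B` and `B†` commute with the closures of all `φ[f]`, `supp f ⊆ A`.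
(When the closures are self-adjoint, this is the von Neumann algebra generated by their
bounded functions.) -/
def localAlgebra (φ : ScalarField d M H) (A : Set M) : VonNeumannAlgebra H where
  toStarSubalgebra := StarSubalgebra.centralizer ℂ
    {B : H →L[ℂ] H | ∀ f : SmearingFunction d M, smearingSupport f ⊆ A →
      CommutesWithUnbounded B (φ.op f).closure ∧ CommutesWithUnbounded (star B) (φ.op f).closure}
  centralizer_centralizer' := by simp

end ScalarField

/-! ### Unitary groups and modular flow -/

/-- A strongly continuous one-parameter unitary group, `U t = exp(-i K t)`. -/
structure IsUnitaryGroup {H : Type*} [NormedAddCommGroup H] [InnerProductSpace ℂ H]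
    [CompleteSpace H] (U : ℝ → unitary (H →L[ℂ] H)) : Prop where
  zero : U 0 = 1
  add : ∀ s t, U (s + t) = U s * U t
  continuous : ∀ v : H, Continuous fun t ↦ (U t : H →L[ℂ] H) v

/-- `Ψ` is cyclic and separating for the von Neumann algebra `𝒜`. -/
def IsCyclicSeparating {H : Type*} [NormedAddCommGroup H] [InnerProductSpace ℂ H]
    [CompleteSpace H] (𝒜 : VonNeumannAlgebra H) (Ψ : H) : Prop :=
  Dense {v : H | ∃ a ∈ 𝒜, a Ψ = v} ∧ ∀ a ∈ 𝒜, a Ψ = 0 → a = 0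

/-- `U t = exp(-i K_Ψ t)` is the modular flow of the state `Ψ` with respect to `𝒜`: it preserves
`Ψ`, preserves `𝒜` and its commutant, and satisfies the KMS condition. -/
structure IsModularFlow {H : Type*} [NormedAddCommGroup H] [InnerProductSpace ℂ H]
    [CompleteSpace H] (𝒜 : VonNeumannAlgebra H) (Ψ : H) (U : ℝ → unitary (H →L[ℂ] H)) : Prop where
  group : IsUnitaryGroup U
  state : ∀ t, (U t : H →L[ℂ] H) Ψ = Ψ
  algebra : ∀ t, ∀ a ∈ 𝒜, star (U t : H →L[ℂ] H) * a * (U t : H →L[ℂ] H) ∈ 𝒜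
  commutant : ∀ t, ∀ a ∈ 𝒜.commutant,
    star (U t : H →L[ℂ] H) * a * (U t : H →L[ℂ] H) ∈ 𝒜.commutant
  kms : ∀ a ∈ 𝒜, ∀ b ∈ 𝒜, ∃ F : ℂ → ℂ,
    ContinuousOn F {z | 0 ≤ z.re ∧ z.re ≤ 1} ∧
    DifferentiableOn ℂ F {z | 0 < z.re ∧ z.re < 1} ∧
    (∃ C : ℝ, ∀ z : ℂ, 0 ≤ z.re → z.re ≤ 1 → ‖F z‖ ≤ C) ∧
    ∀ t : ℝ,
      F (Complex.I * t) = ⟪Ψ, (star (U t : H →L[ℂ] H) * a * (U t : H →L[ℂ] H) * b) Ψ⟫_ℂ ∧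
      F (1 + Complex.I * t) = ⟪Ψ, (b * (star (U t : H →L[ℂ] H) * a * (U t : H →L[ℂ] H))) Ψ⟫_ℂ

end

/-!
The causal structure determines the conformal class of the metric, and a geometric unitary flow is
forced to respect the causal structure.

*Spacelike separation determines the light cones.* If `v` is a spacelike vector at `p`, then the
points of the coordinate line `p + s v` are spacelike separated from `p` for small `s > 0`
(`Spacetime.eventually_spacelikeSeparated`): some future timelike `u` is orthogonal to `v`, the
linear function `g_p(u, ·)` of the coordinates is strictly monotone along causal curves near `p`, and
strong causality keeps the causal curves in question near `p`. Conversely, displacements in nearly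
timelike directions are realized by timelike curves (`Spacetime.exists_timelikeStep`). Hence the
differential of a map preserving spacelike separation does not send spacelike vectors to timelike
ones, and the same holds for the inverse map. A quadratic form with these sign properties vanishes on
the null cone and is therefore a multiple of the metric (`IsLorentzBasis.exists_eq_smul`), so the map
is conformal (`Spacetime.metric_mfderiv_eq_scaling`). The square of the conformal factor is the
smooth function `Spacetime.scaling`.

*Geometric flows preserve spacelike separation.* In a globally hyperbolic spacetime the causal
relation is closed (`Spacetime.isClosed_causalLE`) and the chronological relation is open. If two
spacelike separated points do not remain so under the flow, then at the boundary of the set of times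
at which they are spacelike separated they are causally but not chronologically related, that is,
null separated. Then there are noncommuting fields localized near the two points at that time,
although they are unitarily conjugate to fields localized near the original points, which commute by
microcausality. The commutation relation passes through the conjugation even though the unitary need
not preserve the common domain, because the field operators are Hermitian
(`ScalarField.FieldsCommute.of_conjugatesTo`).

*The generator.* Differentiating `ψ_t^* g = c(t) g` at `t = 0` in a chart gives the conformal Killing
equation with factor `c'(0)` (`lieDerivative_eq`, `Spacetime.covDeriv_add_covDeriv`), since the
symmetrized Levi-Civita derivative of the lowered generator is the Lie derivative of the metric. The
statement for modular flows is the special case in which the unitary group is a modular group.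
-/

noncomputable section

/-! ### Lorentzian linear algebra -/

section LorentzForm

variable {V : Type*} [AddCommGroup V] [Module ℝ V] {n : ℕ}

/-- The basis `b` is orthonormal for the bilinear form `g` of signature `(-,+,…,+)`. -/
def IsLorentzBasis (g : V →ₗ[ℝ] V →ₗ[ℝ] ℝ) (b : Module.Basis (Fin (n + 1)) ℝ V) : Prop :=
  ∀ i j, g (b i) (b j) = if i = j then (if i = 0 then -1 else 1) else 0

namespace IsLorentzBasis

variable {g : V →ₗ[ℝ] V →ₗ[ℝ] ℝ} {b : Module.Basis (Fin (n + 1)) ℝ V}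

lemma apply_eq (hb : IsLorentzBasis g b) (v w : V) :
    g v w = -(b.repr v 0 * b.repr w 0) + ∑ i : Fin n, b.repr v i.succ * b.repr w i.succ := by
  have hb' : ∀ i j, g (b i) (b j) = if i = j then (if i = 0 then -1 else 1) else 0 := hb
  conv_lhs => rw [← b.sum_repr v, ← b.sum_repr w]
  simp only [map_sum, map_smul, LinearMap.sum_apply, LinearMap.smul_apply, hb', smul_eq_mul,
    mul_ite, mul_one, mul_zero, mul_neg, Finset.sum_ite_eq', Finset.mem_univ,
    if_true]
  rw [Fin.sum_univ_succ]
  simp [Fin.succ_ne_zero, mul_comm]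

/-- The orthogonal complement of a timelike vector is spacelike. -/
lemma pos_of_orthogonal (hb : IsLorentzBasis g b) {u w : V} (hu : g u u < 0) (huw : g w u = 0)
    (hw : w ≠ 0) : 0 < g w w := by
  rw [hb.apply_eq] at hu huw ⊢
  set A := ∑ i : Fin n, b.repr u i.succ * b.repr u i.succ with hA
  set B := ∑ i : Fin n, b.repr w i.succ * b.repr w i.succ with hB
  set D := ∑ i : Fin n, b.repr w i.succ * b.repr u i.succ with hD
  have hcs : D ^ 2 ≤ B * A := by
    have := Finset.sum_mul_sq_le_sq_mul_sq Finset.univ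
      (fun i : Fin n ↦ b.repr w i.succ) (fun i : Fin n ↦ b.repr u i.succ)
    simpa [hA, hB, hD, pow_two] using this
  have hA0 : 0 ≤ A := Finset.sum_nonneg fun i _ ↦ mul_self_nonneg _
  have hB0 : 0 ≤ B := Finset.sum_nonneg fun i _ ↦ mul_self_nonneg _
  set u0 := b.repr u 0
  set w0 := b.repr w 0
  have hD' : D = w0 * u0 := by linarith
  have hu0 : 0 < u0 * u0 := by linarith
  rcases hB0.eq_or_lt with hB' | hB'
  · -- the spatial part of `w` vanishes, hence so does its time component, and `w = 0`
    exfalso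
    apply hw
    have h1 : w0 ^ 2 * (u0 * u0) ≤ 0 := by
      have : D ^ 2 ≤ 0 := by simpa [← hB'] using hcs
      rw [hD'] at this; nlinarith
    have hw0 : w0 = 0 := by
      by_contra h
      have : 0 < w0 ^ 2 := by positivity
      nlinarith [mul_pos this hu0]
    have hws : ∀ i : Fin n, b.repr w i.succ = 0 := by
      intro i
      have := (Finset.sum_eq_zero_iff_of_nonneg
        (fun i _ ↦ mul_self_nonneg (b.repr w (Fin.succ i)))).1 hB'.symm i (Finset.mem_univ _)
      simpa using this
    apply b.repr.injective
    ext i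
    refine Fin.cases ?_ ?_ i
    · simpa using hw0
    · intro i; simpa using hws i
  · have h1 : (w0 * w0) * (u0 * u0) < B * (u0 * u0) := by
      calc (w0 * w0) * (u0 * u0) = D ^ 2 := by rw [hD']; ring
        _ ≤ B * A := hcs
        _ < B * (u0 * u0) := by apply mul_lt_mul_of_pos_left _ hB'; linarith
    have := lt_of_mul_lt_mul_right h1 hu0.le
    linarith

/-- A nonzero causal vector in the closed half-space of a timelike vector `t` lies in the open
half-space of every timelike vector `u` with the same time orientation: otherwise it would be
orthogonal to some timelike combination of `t` and `u`. -/
lemma neg_of_causal (hb : IsLorentzBasis g b) (hsymm : ∀ v w, g v w = g w v) {t u w : V}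
    (ht : g t t < 0) (hu : g u u < 0) (hut : g u t < 0) (hw : w ≠ 0) (hww : g w w ≤ 0)
    (hwt : g w t ≤ 0) : g w u < 0 := by
  by_contra! h
  rcases hwt.eq_or_lt with h0 | h0
  · exact absurd (hb.pos_of_orthogonal ht h0 hw) (not_lt.2 hww)
  · refine absurd (hb.pos_of_orthogonal (u := g w u • t + (-g w t) • u) ?_ ?_ hw) (not_lt.2 hww)
    · simp only [map_add, map_smul, LinearMap.add_apply, LinearMap.smul_apply, smul_eq_mul,
        hsymm t u]
      have h1 : 0 < -g w t := by linarith
      nlinarith [mul_nonneg (mul_nonneg h h) (neg_nonneg.2 ht.le), mul_pos (mul_pos h1 h1)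
        (neg_pos.2 hu), mul_nonneg (mul_nonneg h h1.le) (neg_nonneg.2 hut.le)]
    · simp only [map_add, map_smul, smul_eq_mul]
      ring

end IsLorentzBasis

/-- If the quadratic form `h` is nonnegative where `g` is positive, then it is nonnegative at
those null vectors of `g` that are not in the radical of `g`. -/
lemma nonneg_of_null_of_nonneg_of_pos {g h : V →ₗ[ℝ] V →ₗ[ℝ] ℝ} (hg : ∀ v w, g v w = g w v)
    (hpos : ∀ v, 0 < g v v → 0 ≤ h v v) {k m : V} (hk : g k k = 0) (hkm : 0 < g k m) :
    0 ≤ h k k := by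
  have hcont : Continuous fun ε : ℝ ↦ h k k + ε * (h k m + h m k) + ε ^ 2 * h m m := by fun_prop
  have hlim := (hcont.tendsto 0).mono_left (nhdsWithin_le_nhds (s := Ioi 0))
  simp only [zero_mul, add_zero, ne_eq, OfNat.ofNat_ne_zero, not_false_eq_true, zero_pow] at hlim
  refine ge_of_tendsto hlim ?_
  have hcont' : Continuous fun ε : ℝ ↦ 2 * g k m + ε * g m m := by fun_prop
  have hev : ∀ᶠ ε : ℝ in 𝓝[>] 0, 0 < 2 * g k m + ε * g m m :=
    ((hcont'.tendsto 0).mono_left nhdsWithin_le_nhds).eventually (lt_mem_nhds (by simpa using hkm))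
  filter_upwards [hev, self_mem_nhdsWithin] with ε h1 (h2 : 0 < ε)
  have := hpos (k + ε • m) (by
    simp only [map_add, map_smul, LinearMap.add_apply, LinearMap.smul_apply, smul_eq_mul, hk,
      hg m k]
    nlinarith [mul_pos h2 h1])
  simp only [map_add, map_smul, LinearMap.add_apply, LinearMap.smul_apply, smul_eq_mul] at this
  linarith

/-- A symmetric bilinear form `h` whose quadratic form is nonnegative on spacelike vectors and
nonpositive on timelike vectors is a nonnegative multiple of the Lorentzian form `g`. It vanishes
on null vectors, and the null vectors `e₀ ± eᵢ` and `√2 e₀ + eᵢ + eⱼ` determine it up to a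
factor. -/
lemma IsLorentzBasis.exists_eq_smul {g h : V →ₗ[ℝ] V →ₗ[ℝ] ℝ}
    {b : Module.Basis (Fin (n + 1)) ℝ V} (hb : IsLorentzBasis g b)
    (hg : ∀ v w, g v w = g w v) (hh : ∀ v w, h v w = h w v)
    (hpos : ∀ v, 0 < g v v → 0 ≤ h v v) (hneg : ∀ v, g v v < 0 → h v v ≤ 0) :
    ∃ c : ℝ, 0 ≤ c ∧ ∀ v w, h v w = c * g v w := by
  have hnull : ∀ k m, g k k = 0 → g k m ≠ 0 → h k k = 0 := by
    intro k m hk hkm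
    apply le_antisymm
    · have := nonneg_of_null_of_nonneg_of_pos (g := -g) (h := -h) (k := k)
        (m := (-g k m) • m) (fun v w ↦ by simp [hg v w])
        (fun v hv ↦ by simpa using hneg v (by simpa using hv)) (by simp [hk])
        (by simpa using mul_self_pos.2 hkm)
      simpa using this
    · exact nonneg_of_null_of_nonneg_of_pos (m := (g k m) • m) hg hpos hk
        (by simpa using mul_self_pos.2 hkm)
  have g00 : g (b 0) (b 0) = -1 := by simp [hb 0 0]
  have gs0 : ∀ i : Fin n, g (b i.succ) (b 0) = 0 := fun i ↦ by simp [hb _ _, Fin.succ_ne_zero]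
  have g0s : ∀ i : Fin n, g (b 0) (b i.succ) = 0 := fun i ↦ by rw [hg, gs0]
  have gss : ∀ i j : Fin n, g (b i.succ) (b j.succ) = if i = j then 1 else 0 := fun i j ↦ by
    simp [hb _ _, Fin.succ_ne_zero]
  have hp : ∀ i : Fin n, h (b 0 + b i.succ) (b 0 + b i.succ) = 0 := fun i ↦
    hnull _ (b 0) (by simp [g00, gs0, g0s, gss]) (by simp [g00, gs0])
  have hm : ∀ i : Fin n, h (b 0 - b i.succ) (b 0 - b i.succ) = 0 := fun i ↦
    hnull _ (b 0) (by simp [g00, gs0, g0s, gss]) (by simp [g00, gs0])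
  have hq : ∀ i j : Fin n, i ≠ j → h (√2 • b 0 + b i.succ + b j.succ)
      (√2 • b 0 + b i.succ + b j.succ) = 0 := fun i j hij ↦
    hnull _ (b 0) (by simp [g00, gs0, g0s, gss, hij, hij.symm]; norm_num)
      (by simp [g00, gs0])
  simp only [map_add, map_sub, map_smul, LinearMap.add_apply, LinearMap.sub_apply,
    LinearMap.smul_apply, smul_eq_mul] at hp hm hq
  have h0s : ∀ i : Fin n, h (b 0) (b i.succ) = 0 := fun i ↦ by
    linarith [hp i, hm i, hh (b 0) (b i.succ)]
  have hs0 : ∀ i : Fin n, h (b i.succ) (b 0) = 0 := fun i ↦ by rw [hh, h0s]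
  have hii : ∀ i : Fin n, h (b i.succ) (b i.succ) = -h (b 0) (b 0) := fun i ↦ by
    linarith [hp i, h0s i, hs0 i]
  have hij : ∀ i j : Fin n, i ≠ j → h (b i.succ) (b j.succ) = 0 := fun i j hne ↦ by
    have h1 := hq i j hne
    simp only [h0s, hs0, hii] at h1
    have h2 : √2 * (√2 * h (b 0) (b 0)) = 2 * h (b 0) (b 0) := by
      rw [← mul_assoc, Real.mul_self_sqrt (by norm_num)]
    linarith [hh (b i.succ) (b j.succ)]
  refine ⟨-h (b 0) (b 0), by linarith [hneg (b 0) (by rw [g00]; norm_num)], ?_⟩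
  have heq : h = (-h (b 0) (b 0)) • g := by
    refine b.ext fun i ↦ b.ext fun j ↦ ?_
    simp only [LinearMap.smul_apply, smul_eq_mul]
    refine Fin.cases ?_ (fun i ↦ ?_) i <;> refine Fin.cases ?_ (fun j ↦ ?_) j
    · rw [g00]; ring
    · rw [h0s, g0s]; ring
    · rw [hs0, gs0]; ring
    · rw [gss]
      by_cases hne : i = j
      · subst hne; simp [hii]
      · simp [hne, hij i j hne]
  intro v w
  conv_lhs => rw [heq]
  simp

end LorentzForm

/-! ### Smoothness of the metric along maps -/

section TangentMap

variable {E₁ H₁ N₁ E₂ H₂ N₂ E₃ H₃ N₃ : Type*}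
  [NormedAddCommGroup E₁] [NormedSpace ℝ E₁] [TopologicalSpace H₁] {I₁ : ModelWithCorners ℝ E₁ H₁}
  [TopologicalSpace N₁] [ChartedSpace H₁ N₁]
  [NormedAddCommGroup E₂] [NormedSpace ℝ E₂] [TopologicalSpace H₂] {I₂ : ModelWithCorners ℝ E₂ H₂}
  [TopologicalSpace N₂] [ChartedSpace H₂ N₂] [IsManifold I₂ ∞ N₂]
  [NormedAddCommGroup E₃] [NormedSpace ℝ E₃] [TopologicalSpace H₃] {I₃ : ModelWithCorners ℝ E₃ H₃}
  [TopologicalSpace N₃] [ChartedSpace H₃ N₃] [IsManifold I₃ ∞ N₃]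

/-- The differential of a smooth map sends a smooth vector field along a map `b` to a smooth
vector field along the composed map. -/
lemma ContMDiffOn.mfderiv_section {f : N₂ → N₃} {s : Set N₂} (hs : IsOpen s)
    (hf : ContMDiffOn I₂ I₃ ∞ f s) {b : N₁ → N₂} {v : ∀ k, TangentSpace I₂ (b k)} {u : Set N₁}
    (hv : ContMDiffOn I₁ I₂.tangent ∞ (fun k ↦ (⟨b k, v k⟩ : TangentBundle I₂ N₂)) u)
    (hb : MapsTo b u s) :
    ContMDiffOn I₁ I₃.tangent ∞
      (fun k ↦ (⟨f (b k), mfderiv I₂ I₃ f (b k) (v k)⟩ : TangentBundle I₃ N₃)) u := by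
  have : IsManifold I₂ 1 N₂ := .of_le (n := ∞) (by simp)
  have : IsManifold I₃ 1 N₃ := .of_le (n := ∞) (by simp)
  have h := (hf.contMDiffOn_tangentMapWithin (m := ∞) (by simp) hs.uniqueMDiffOn).comp hv
    (fun k hk ↦ hb hk)
  refine h.congr fun k hk ↦ ?_
  simp only [Function.comp, tangentMapWithin, mfderivWithin_of_isOpen hs (hb hk)]

end TangentMap

namespace Spacetime

variable {d : ℕ} {M : Type*} [TopologicalSpace M]
  [ChartedSpace (EuclideanSpace ℝ (Fin (d + 1))) M] [IsManifold (𝓡 (d + 1)) ∞ M]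
  (S : Spacetime d M)

lemma contMDiffOn_metric {E₁ H₁ N₁ : Type*} [NormedAddCommGroup E₁] [NormedSpace ℝ E₁]
    [TopologicalSpace H₁] {I₁ : ModelWithCorners ℝ E₁ H₁} [TopologicalSpace N₁]
    [ChartedSpace H₁ N₁] {b : N₁ → M} {v w : ∀ k, TangentSpace (𝓡 (d + 1)) (b k)} {u : Set N₁}
    (hv : ContMDiffOn I₁ (𝓡 (d + 1)).tangent ∞
      (fun k ↦ (⟨b k, v k⟩ : TangentBundle (𝓡 (d + 1)) M)) u)
    (hw : ContMDiffOn I₁ (𝓡 (d + 1)).tangent ∞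
      (fun k ↦ (⟨b k, w k⟩ : TangentBundle (𝓡 (d + 1)) M)) u) :
    ContMDiffOn I₁ 𝓘(ℝ, ℝ) ∞ (fun k ↦ S.metric (b k) (v k) (w k)) u := by
  intro x hx
  have hb : ContMDiffWithinAt I₁ (𝓡 (d + 1)) ∞ b u x := by
    have := hv x hx
    simp only [contMDiffWithinAt_totalSpace] at this
    exact this.1
  have : ContMDiffWithinAt I₁ ((𝓡 (d + 1)).prod 𝓘(ℝ, ℝ)) ∞
      (fun m ↦ TotalSpace.mk' ℝ (E := Bundle.Trivial M ℝ) (b m)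
        (S.metric (b m) (v m) (w m))) u x := by
    apply ContMDiffWithinAt.clm_bundle_apply₂ (F₁ := EuclideanSpace ℝ (Fin (d + 1)))
      (F₂ := EuclideanSpace ℝ (Fin (d + 1)))
    · exact ContMDiffAt.comp_contMDiffWithinAt x S.smooth_metric.contMDiffAt hb
    · exact hv x hx
    · exact hw x hx
  simp only [contMDiffWithinAt_totalSpace] at this
  exact this.2

/-- The tangent vector at `e.symm y` with components `w` in the chart `e` at `p`. -/
def chartVec (p : M) (y w : EuclideanSpace ℝ (Fin (d + 1))) :
    TangentSpace (𝓡 (d + 1)) ((extChartAt (𝓡 (d + 1)) p).symm y) :=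
  mfderiv 𝓘(ℝ, EuclideanSpace ℝ (Fin (d + 1))) (𝓡 (d + 1)) (extChartAt (𝓡 (d + 1)) p).symm y w

omit [IsManifold (𝓡 (d + 1)) ∞ M] in
lemma chartVec_smul (p : M) (y w : EuclideanSpace ℝ (Fin (d + 1))) (c : ℝ) :
    chartVec p y (c • w) = c • chartVec p y w := map_smul _ _ _

lemma contMDiffOn_chartVec (p : M) {E₁ H₁ N₁ : Type*} [NormedAddCommGroup E₁] [NormedSpace ℝ E₁]
    [TopologicalSpace H₁] {I₁ : ModelWithCorners ℝ E₁ H₁} [TopologicalSpace N₁]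
    [ChartedSpace H₁ N₁] {b v : N₁ → EuclideanSpace ℝ (Fin (d + 1))} {u : Set N₁}
    (hb : ContMDiffOn I₁ 𝓘(ℝ, EuclideanSpace ℝ (Fin (d + 1))) ∞ b u)
    (hv : ContMDiffOn I₁ 𝓘(ℝ, EuclideanSpace ℝ (Fin (d + 1))) ∞ v u)
    (hmaps : MapsTo b u (extChartAt (𝓡 (d + 1)) p).target) :
    ContMDiffOn I₁ (𝓡 (d + 1)).tangent ∞ (fun k ↦
      (⟨_, chartVec p (b k) (v k)⟩ : TangentBundle (𝓡 (d + 1)) M)) u := by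
  refine ContMDiffOn.mfderiv_section (I₂ := 𝓘(ℝ, EuclideanSpace ℝ (Fin (d + 1))))
    (isOpen_extChartAt_target p) (contMDiffOn_extChartAt_symm p) (v := v) ?_ hmaps
  have h := hb.prodMk hv
  rw [chartedSpaceSelf_prod] at h
  exact (contMDiff_tangentBundleModelSpaceHomeomorph_symm
    (I := 𝓘(ℝ, EuclideanSpace ℝ (Fin (d + 1))))).comp_contMDiffOn h

/-- In the chart at `p`, the components at `p` of a tangent vector are the vector itself. -/
lemma chartVec_self (p : M) (v : EuclideanSpace ℝ (Fin (d + 1))) :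
    (chartVec p (extChartAt (𝓡 (d + 1)) p p) v : EuclideanSpace ℝ (Fin (d + 1))) = v := by
  have : IsManifold (𝓡 (d + 1)) 1 M := .of_le (n := ∞) (by simp)
  have h := mfderivWithin_range_extChartAt_symm (I := 𝓡 (d + 1)) (x := p)
  rw [modelWithCornersSelf_coe, range_id, mfderivWithin_univ] at h
  exact DFunLike.congr_fun h v

lemma metric_chartVec_self (p : M) (v w : TangentSpace (𝓡 (d + 1)) p) :
    S.metric _ (chartVec p (extChartAt (𝓡 (d + 1)) p p) v)
      (chartVec p (extChartAt (𝓡 (d + 1)) p p) w) = S.metric p v w := by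
  have key : ∀ q, q = p → ∀ v w : EuclideanSpace ℝ (Fin (d + 1)),
      S.metric q v w = S.metric p v w := by rintro _ rfl _ _; rfl
  exact (key _ (extChartAt_to_inv p) _ _).trans
    (congrArg₂ (fun a b : EuclideanSpace ℝ (Fin (d + 1)) ↦ S.metric p a b)
      (chartVec_self p v) (chartVec_self p w))

lemma metric_chartVec_self_time (p : M) (v : TangentSpace (𝓡 (d + 1)) p) :
    S.metric _ (chartVec p (extChartAt (𝓡 (d + 1)) p p) v) (S.time _) =
      S.metric p v (S.time p) := by
  have key : ∀ q, q = p → ∀ v : EuclideanSpace ℝ (Fin (d + 1)),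
      S.metric q v (S.time q) = S.metric p v (S.time p) := by rintro _ rfl _; rfl
  exact (key _ (extChartAt_to_inv p) _).trans
    (congrArg (fun a : EuclideanSpace ℝ (Fin (d + 1)) ↦ S.metric p a (S.time p))
      (chartVec_self p v))

lemma contMDiffOn_time_comp {E₁ H₁ N₁ : Type*} [NormedAddCommGroup E₁] [NormedSpace ℝ E₁]
    [TopologicalSpace H₁] {I₁ : ModelWithCorners ℝ E₁ H₁} [TopologicalSpace N₁]
    [ChartedSpace H₁ N₁]
    {b : N₁ → M} {u : Set N₁} (hb : ContMDiffOn I₁ (𝓡 (d + 1)) ∞ b u) :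
    ContMDiffOn I₁ (𝓡 (d + 1)).tangent ∞
      (fun k ↦ (⟨b k, S.time (b k)⟩ : TangentBundle (𝓡 (d + 1)) M)) u :=
  S.smooth_time.comp_contMDiffOn hb

/-- `g(w, w)` as a function of the base point and of the components of `w` in a chart. -/
lemma continuousOn_metric_chartVec (p : M) :
    ContinuousOn (fun z : EuclideanSpace ℝ (Fin (d + 1)) × EuclideanSpace ℝ (Fin (d + 1)) ↦
      S.metric _ (chartVec p z.1 z.2) (chartVec p z.1 z.2))
      ((extChartAt (𝓡 (d + 1)) p).target ×ˢ univ) := by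
  have h : ContMDiffOn (𝓘(ℝ, EuclideanSpace ℝ (Fin (d + 1)) × EuclideanSpace ℝ (Fin (d + 1))))
      (𝓡 (d + 1)).tangent ∞
      (fun z : EuclideanSpace ℝ (Fin (d + 1)) × EuclideanSpace ℝ (Fin (d + 1)) ↦
      (⟨_, chartVec p z.1 z.2⟩ : TangentBundle (𝓡 (d + 1)) M))
      ((extChartAt (𝓡 (d + 1)) p).target ×ˢ univ) :=
    contMDiffOn_chartVec p contDiff_fst.contMDiff.contMDiffOn contDiff_snd.contMDiff.contMDiffOn
      (fun z hz ↦ hz.1)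
  exact (S.contMDiffOn_metric h h).continuousOn

/-- `g(w, T)`, for the time orientation `T`, as a function of the base point and of the components
of `w` in a chart. -/
lemma continuousOn_metric_chartVec_time (p : M) :
    ContinuousOn (fun z : EuclideanSpace ℝ (Fin (d + 1)) × EuclideanSpace ℝ (Fin (d + 1)) ↦
      S.metric _ (chartVec p z.1 z.2) (S.time _))
      ((extChartAt (𝓡 (d + 1)) p).target ×ˢ univ) := by
  have hfst : ContMDiffOn
      (𝓘(ℝ, EuclideanSpace ℝ (Fin (d + 1)) × EuclideanSpace ℝ (Fin (d + 1))))
      𝓘(ℝ, EuclideanSpace ℝ (Fin (d + 1))) ∞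
      (fun z : EuclideanSpace ℝ (Fin (d + 1)) × EuclideanSpace ℝ (Fin (d + 1)) ↦ z.1)
      ((extChartAt (𝓡 (d + 1)) p).target ×ˢ univ) := contDiff_fst.contMDiff.contMDiffOn
  refine (S.contMDiffOn_metric (contMDiffOn_chartVec p hfst contDiff_snd.contMDiff.contMDiffOn
      (fun z hz ↦ hz.1)) (S.contMDiffOn_time_comp ?_)).continuousOn
  exact (contMDiffOn_extChartAt_symm p).comp hfst fun z hz ↦ hz.1

lemma contDiffOn_metricInChart (p : M) :
    ContDiffOn ℝ ∞ (S.metricInChart p) (extChartAt (𝓡 (d + 1)) p).target := by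
  rw [contDiffOn_clm_apply]
  intro v
  rw [contDiffOn_clm_apply]
  intro w
  rw [← contMDiffOn_iff_contDiffOn]
  exact S.contMDiffOn_metric (contMDiffOn_chartVec p contMDiffOn_id contMDiffOn_const
    fun _ h ↦ h) (contMDiffOn_chartVec p contMDiffOn_id contMDiffOn_const fun _ h ↦ h)

/-! ### Timelike and causal vectors -/

/-- The metric at a point as a bilinear form. -/
def form (p : M) : TangentSpace (𝓡 (d + 1)) p →ₗ[ℝ] TangentSpace (𝓡 (d + 1)) p →ₗ[ℝ] ℝ :=
  LinearMap.mk₂ ℝ (fun v w ↦ S.metric p v w) (by simp) (by simp) (by simp) (by simp)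

@[simp] lemma form_apply (p : M) (v w : TangentSpace (𝓡 (d + 1)) p) :
    S.form p v w = S.metric p v w := rfl

lemma exists_isLorentzBasis (p : M) :
    ∃ b : Module.Basis (Fin (d + 1)) ℝ (TangentSpace (𝓡 (d + 1)) p), IsLorentzBasis (S.form p) b :=
  S.lorentzian p

variable {S} {p : M}

lemma FutureTimelike.smul {v : TangentSpace (𝓡 (d + 1)) p} (h : S.FutureTimelike p v) {c : ℝ}
    (hc : 0 < c) : S.FutureTimelike p (c • v) := by
  obtain ⟨h1, h2⟩ := h
  constructor
  · simp only [map_smul, smul_apply, smul_eq_mul]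
    exact mul_neg_of_pos_of_neg hc (mul_neg_of_pos_of_neg hc h1)
  · simp only [map_smul, smul_apply, smul_eq_mul]
    exact mul_neg_of_pos_of_neg hc h2

lemma FutureCausal.smul {v : TangentSpace (𝓡 (d + 1)) p} (h : S.FutureCausal p v) {c : ℝ}
    (hc : 0 < c) : S.FutureCausal p (c • v) := by
  obtain ⟨h1, h2⟩ := h
  constructor
  · simp only [map_smul, smul_apply, smul_eq_mul]
    exact mul_nonpos_of_nonneg_of_nonpos hc.le (mul_nonpos_of_nonneg_of_nonpos hc.le h1)
  · simp only [map_smul, smul_apply, smul_eq_mul]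
    exact mul_neg_of_pos_of_neg hc h2

lemma FutureTimelike.futureCausal {v : TangentSpace (𝓡 (d + 1)) p} (h : S.FutureTimelike p v) :
    S.FutureCausal p v := ⟨h.1.le, h.2⟩

lemma futureTimelike_time : S.FutureTimelike p (S.time p) :=
  ⟨S.time_timelike p, S.time_timelike p⟩

/-- A timelike vector is future-directed or past-directed. -/
lemma futureTimelike_or_neg {v : TangentSpace (𝓡 (d + 1)) p} (h : S.metric p v v < 0) :
    S.FutureTimelike p v ∨ S.FutureTimelike p (-v) := by
  rcases lt_trichotomy (S.metric p v (S.time p)) 0 with h1 | h1 | h1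
  · exact .inl ⟨h, h1⟩
  · exfalso
    obtain ⟨b, hb⟩ := S.exists_isLorentzBasis p
    have hv : v ≠ 0 := by rintro rfl; simp at h
    exact absurd (hb.pos_of_orthogonal (S.time_timelike p) h1 hv) (not_lt.2 h.le)
  · exact .inr ⟨by simpa using h, by simpa using h1⟩

end Spacetime

namespace Spacetime

variable {d : ℕ} {M : Type*} [TopologicalSpace M]
  [ChartedSpace (EuclideanSpace ℝ (Fin (d + 1))) M]

/-! ### Curves in a field of cones -/

/-- The curve `γ : [0, 1] → M` is `C¹`, with velocities in the cones `C`. -/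
def IsConeCurve (C : ∀ p : M, TangentSpace (𝓡 (d + 1)) p → Prop) (γ : ℝ → M) : Prop :=
  ContMDiffOn 𝓘(ℝ, ℝ) (𝓡 (d + 1)) 1 γ (Icc 0 1) ∧
    ∀ t ∈ Icc (0 : ℝ) 1, C (γ t) (mfderivWithin 𝓘(ℝ, ℝ) (𝓡 (d + 1)) γ (Icc 0 1) t (1 : ℝ))

/-- A piece of a curve, parametrized affinely by `[0, 1]`, is again a curve in the cones. -/
lemma IsConeCurve.restrict {C : ∀ p : M, TangentSpace (𝓡 (d + 1)) p → Prop} {γ : ℝ → M}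
    (hγ : IsConeCurve C γ) (hC : ∀ p v, C p v → ∀ c : ℝ, 0 < c → C p (c • v)) {a b : ℝ}
    (ha : 0 ≤ a) (hab : a < b) (hb : b ≤ 1) :
    IsConeCurve C (fun s ↦ γ (a + s * (b - a))) := by
  obtain ⟨hγ, hγC⟩ := hγ
  have hmaps : MapsTo (fun s : ℝ ↦ a + s * (b - a)) (Icc 0 1) (Icc 0 1) := by
    rintro s ⟨h0, h1⟩
    constructor <;> nlinarith
  have hsub : Icc (0 : ℝ) 1 ⊆ (fun s : ℝ ↦ a + s * (b - a)) ⁻¹' Icc 0 1 := hmaps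
  have haff : ContDiff ℝ 1 (fun s : ℝ ↦ a + s * (b - a)) := by fun_prop
  refine ⟨hγ.comp haff.contMDiff.contMDiffOn hmaps, fun t ht ↦ ?_⟩
  have h1 : HasMFDerivWithinAt 𝓘(ℝ, ℝ) (𝓡 (d + 1)) γ (Icc 0 1) (a + t * (b - a)) _ :=
    ((hγ _ (hmaps ht)).mdifferentiableWithinAt one_ne_zero).hasMFDerivWithinAt
  have h2 : HasDerivWithinAt (fun s : ℝ ↦ a + s * (b - a)) (b - a) (Icc 0 1) t := by
    simpa using (((hasDerivAt_id t).mul_const (b - a)).const_add a).hasDerivWithinAt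
  have h3 := (h1.comp t h2.hasFDerivWithinAt.hasMFDerivWithinAt hsub).mfderivWithin ((uniqueDiffOn_Icc zero_lt_one).uniqueMDiffOn t ht)
  have h4 := hC _ _ (hγC _ (hmaps ht)) (b - a) (by linarith)
  have h5 : mfderivWithin 𝓘(ℝ, ℝ) (𝓡 (d + 1)) (γ ∘ fun s : ℝ ↦ a + s * (b - a)) (Icc 0 1) t
      (1 : ℝ) = (b - a) • mfderivWithin 𝓘(ℝ, ℝ) (𝓡 (d + 1)) γ (Icc 0 1) (a + t * (b - a))
        (1 : ℝ) := by
    rw [h3]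
    refine Eq.trans ?_ (map_smul _ _ _)
    refine congrArg (mfderivWithin 𝓘(ℝ, ℝ) (𝓡 (d + 1)) γ (Icc 0 1) (a + t * (b - a))) ?_
    change (1 : ℝ) • (b - a) = (b - a) • (1 : ℝ)
    simp
  exact (congrArg (C _) h5).mpr h4

variable [IsManifold (𝓡 (d + 1)) ∞ M] {S : Spacetime d M}

lemma timelikeStep_iff {x y : M} :
    S.TimelikeStep x y ↔ ∃ γ, IsConeCurve S.FutureTimelike γ ∧ γ 0 = x ∧ γ 1 = y :=
  ⟨fun ⟨γ, h1, h2, h3, h4⟩ ↦ ⟨γ, ⟨h1, h4⟩, h2, h3⟩, fun ⟨γ, ⟨h1, h4⟩, h2, h3⟩ ↦ ⟨γ, h1, h2, h3, h4⟩⟩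

lemma causalStep_iff {x y : M} :
    S.CausalStep x y ↔ ∃ γ, IsConeCurve S.FutureCausal γ ∧ γ 0 = x ∧ γ 1 = y :=
  ⟨fun ⟨γ, h1, h2, h3, h4⟩ ↦ ⟨γ, ⟨h1, h4⟩, h2, h3⟩, fun ⟨γ, ⟨h1, h4⟩, h2, h3⟩ ↦ ⟨γ, h1, h2, h3, h4⟩⟩

lemma IsConeCurve.timelikeStep {γ : ℝ → M} (hγ : IsConeCurve S.FutureTimelike γ) {a b : ℝ}
    (ha : 0 ≤ a) (hab : a < b) (hb : b ≤ 1) : S.TimelikeStep (γ a) (γ b) :=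
  timelikeStep_iff.2 ⟨_, hγ.restrict (fun _ _ h _ ↦ h.smul) ha hab hb, by simp, by simp⟩

lemma IsConeCurve.causalStep {γ : ℝ → M} (hγ : IsConeCurve S.FutureCausal γ) {a b : ℝ}
    (ha : 0 ≤ a) (hab : a < b) (hb : b ≤ 1) : S.CausalStep (γ a) (γ b) :=
  causalStep_iff.2 ⟨_, hγ.restrict (fun _ _ h _ ↦ h.smul) ha hab hb, by simp, by simp⟩

lemma IsConeCurve.causalLE {γ : ℝ → M} (hγ : IsConeCurve S.FutureCausal γ) {a b : ℝ}
    (ha : 0 ≤ a) (hab : a ≤ b) (hb : b ≤ 1) : S.CausalLE (γ a) (γ b) := by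
  rcases hab.eq_or_lt with rfl | h
  · exact Relation.ReflTransGen.refl
  · exact Relation.ReflTransGen.single (hγ.causalStep ha h hb)

lemma TimelikeStep.causalStep {x y : M} (h : S.TimelikeStep x y) : S.CausalStep x y := by
  obtain ⟨γ, h1, h2, h3, h4⟩ := h
  exact ⟨γ, h1, h2, h3, fun t ht ↦ (h4 t ht).futureCausal⟩

lemma TimelikeStep.chronLT {x y : M} (h : S.TimelikeStep x y) : S.ChronLT x y :=
  Relation.TransGen.single h

lemma TimelikeStep.causalLE {x y : M} (h : S.TimelikeStep x y) : S.CausalLE x y :=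
  Relation.ReflTransGen.single h.causalStep

lemma ChronLT.causalLE {x y : M} (h : S.ChronLT x y) : S.CausalLE x y :=
  Relation.ReflTransGen.mono (fun _ _ h ↦ TimelikeStep.causalStep h) _ _ h.to_reflTransGen

/-! ### Straight timelike lines in a chart -/

/-- Coordinate displacements close to a given future timelike vector at `p` are realized, near
`p`, by timelike curves. -/
lemma exists_timelikeStep {p : M} {v : TangentSpace (𝓡 (d + 1)) p} (hv : S.FutureTimelike p v) :
    ∃ U ∈ 𝓝 p, ∃ W : Set (EuclideanSpace ℝ (Fin (d + 1))), IsOpen W ∧ v ∈ W ∧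
      ∀ x ∈ U, ∀ y ∈ U, ∀ s : ℝ, 0 < s →
        s⁻¹ • (extChartAt (𝓡 (d + 1)) p y - extChartAt (𝓡 (d + 1)) p x) ∈ W →
          S.TimelikeStep x y := by
  set e := extChartAt (𝓡 (d + 1)) p with he
  have hopen : IsOpen e.target := isOpen_extChartAt_target p
  have hmem : (e.target ×ˢ univ : Set (EuclideanSpace ℝ (Fin (d + 1)) ×
      EuclideanSpace ℝ (Fin (d + 1)))) ∈ 𝓝 (e p, (v : EuclideanSpace ℝ (Fin (d + 1)))) :=
    (hopen.prod isOpen_univ).mem_nhds ⟨mem_extChartAt_target p, mem_univ _⟩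
  have h1 := ((S.continuousOn_metric_chartVec p).continuousAt hmem).eventually_lt
    (continuousAt_const (y := (0 : ℝ))) 
      ((S.metric_chartVec_self p v v).trans_lt hv.1)
  have h2 := ((S.continuousOn_metric_chartVec_time p).continuousAt hmem).eventually_lt
    (continuousAt_const (y := (0 : ℝ))) 
      ((S.metric_chartVec_self_time p v).trans_lt hv.2)
  obtain ⟨B, hB, W, hW, hBW⟩ := mem_nhds_prod_iff.1 (Filter.inter_mem (h1.and h2) hmem)
  obtain ⟨r, hr, hrB⟩ := Metric.mem_nhds_iff.1 hB
  obtain ⟨W', hW'W, hW', hvW'⟩ := mem_nhds_iff.1 hW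
  refine ⟨e.source ∩ e ⁻¹' Metric.ball (e p) r, ?_, W', hW', hvW', ?_⟩
  · exact Filter.inter_mem (extChartAt_source_mem_nhds p)
      ((continuousAt_extChartAt p).preimage_mem_nhds (Metric.ball_mem_nhds _ hr))
  rintro x ⟨hxs, hxB⟩ y ⟨hys, hyB⟩ s hs hsW
  have hline : ∀ t ∈ Icc (0 : ℝ) 1, e x + t • (e y - e x) ∈ Metric.ball (e p) r := fun t ht ↦
    (convex_ball (e p) r).add_smul_sub_mem hxB hyB ht
  have hgood : ∀ z ∈ Metric.ball (e p) r, S.FutureTimelike (e.symm z) (chartVec p z (e y - e x)) ∧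
      z ∈ e.target := by
    intro z hz
    have h := hBW (show (z, s⁻¹ • (e y - e x)) ∈ B ×ˢ W from ⟨hrB hz, hW'W hsW⟩)
    refine ⟨?_, h.2.1⟩
    have h' : S.FutureTimelike (e.symm z) (chartVec p z (s⁻¹ • (e y - e x))) := h.1
    have h'' := h'.smul hs
    rw [← chartVec_smul] at h''
    rwa [smul_smul, mul_inv_cancel₀ hs.ne', one_smul] at h''
  have hmaps : MapsTo (fun t : ℝ ↦ e x + t • (e y - e x)) (Icc 0 1) e.target :=
    fun t ht ↦ (hgood _ (hline t ht)).2
  have hlin : ContDiff ℝ 1 (fun t : ℝ ↦ e x + t • (e y - e x)) := by fun_prop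
  refine ⟨fun t ↦ e.symm (e x + t • (e y - e x)), ?_, ?_, ?_, ?_⟩
  · exact ((contMDiffOn_extChartAt_symm (n := ∞) p).of_le (by simp)).comp hlin.contMDiff.contMDiffOn hmaps
  · simp [e.left_inv hxs]
  · simp [e.left_inv hys]
  · intro t ht
    have h1 : HasMFDerivAt 𝓘(ℝ, EuclideanSpace ℝ (Fin (d + 1))) (𝓡 (d + 1)) e.symm
        (e x + t • (e y - e x)) _ :=
      ((contMDiffOn_extChartAt_symm (n := ∞) p).contMDiffAt (hopen.mem_nhds (hmaps ht))
        |>.mdifferentiableAt (by simp)).hasMFDerivAt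
    have h2 : HasDerivAt (fun t : ℝ ↦ e x + t • (e y - e x)) (e y - e x) t := by
      simpa using ((hasDerivAt_id t).smul_const (e y - e x)).const_add (e x)
    have h3 := (HasMFDerivAt.comp t h1 h2.hasFDerivAt.hasMFDerivAt).hasMFDerivWithinAt
      (s := Icc 0 1) |>.mfderivWithin ((uniqueDiffOn_Icc zero_lt_one).uniqueMDiffOn t ht)
    have h4 := (hgood _ (hline t ht)).1
    have h5 : mfderivWithin 𝓘(ℝ, ℝ) (𝓡 (d + 1))
        (e.symm ∘ fun t : ℝ ↦ e x + t • (e y - e x)) (Icc 0 1) t (1 : ℝ) =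
        chartVec p (e x + t • (e y - e x)) (e y - e x) := by
      rw [h3]
      exact congrArg (mfderiv 𝓘(ℝ, EuclideanSpace ℝ (Fin (d + 1))) (𝓡 (d + 1)) e.symm
        (e x + t • (e y - e x))) (one_smul ℝ (e y - e x))
    exact (congrArg (S.FutureTimelike _) h5).mpr h4

end Spacetime

namespace Spacetime

variable {d : ℕ} {M : Type*} [TopologicalSpace M]
  [ChartedSpace (EuclideanSpace ℝ (Fin (d + 1))) M]

/-! ### Openness of the chronological relation -/

lemma hasDerivWithinAt_extChartAt_comp {γ : ℝ → M} {s : Set ℝ} {t : ℝ}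
    {f' : TangentSpace 𝓘(ℝ, ℝ) t →L[ℝ] TangentSpace (𝓡 (d + 1)) (γ t)}
    (h : HasMFDerivWithinAt 𝓘(ℝ, ℝ) (𝓡 (d + 1)) γ s t f') :
    HasDerivWithinAt (fun u ↦ extChartAt (𝓡 (d + 1)) (γ t) (γ u))
      (f' (1 : ℝ) : EuclideanSpace ℝ (Fin (d + 1))) s t := by
  have h2 := h.2
  simp only [writtenInExtChartAt, mfld_simps] at h2
  exact HasFDerivWithinAt.hasDerivWithinAt h2

/-- The straight coordinate line through `p` with velocity `v`, in the chart at `p`. -/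
def coordLine (p : M) (v : EuclideanSpace ℝ (Fin (d + 1))) (s : ℝ) : M :=
  (extChartAt (𝓡 (d + 1)) p).symm (extChartAt (𝓡 (d + 1)) p p + s • v)

lemma coordLine_zero (p : M) (v : EuclideanSpace ℝ (Fin (d + 1))) : coordLine p v 0 = p := by
  rw [coordLine, zero_smul, add_zero, extChartAt_to_inv]

lemma eventually_extChartAt_coordLine (p : M) (v : EuclideanSpace ℝ (Fin (d + 1))) :
    ∀ᶠ s : ℝ in 𝓝 0, extChartAt (𝓡 (d + 1)) p (coordLine p v s) =
        extChartAt (𝓡 (d + 1)) p p + s • v := by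
  have hc : Continuous fun s : ℝ ↦ extChartAt (𝓡 (d + 1)) p p + s • v := by fun_prop
  have h : ∀ᶠ s : ℝ in 𝓝 0, extChartAt (𝓡 (d + 1)) p p + s • v ∈
      (extChartAt (𝓡 (d + 1)) p).target :=
    hc.continuousAt.eventually_mem (by simpa using extChartAt_target_mem_nhds (I := 𝓡 (d + 1)) p)
  exact h.mono fun s hs ↦ (extChartAt (𝓡 (d + 1)) p).right_inv hs

lemma tendsto_coordLine (p : M) (v : EuclideanSpace ℝ (Fin (d + 1))) :
    Filter.Tendsto (coordLine p v) (𝓝 0) (𝓝 p) := by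
  have hc : Continuous fun s : ℝ ↦ extChartAt (𝓡 (d + 1)) p p + s • v := by fun_prop
  have h1 : Filter.Tendsto (fun s : ℝ ↦ extChartAt (𝓡 (d + 1)) p p + s • v) (𝓝 0)
      (𝓝 (extChartAt (𝓡 (d + 1)) p p)) := by simpa using hc.tendsto 0
  have h2 := (continuousAt_extChartAt_symm (I := 𝓡 (d + 1)) p).tendsto.comp h1
  rwa [extChartAt_to_inv] at h2

variable [IsManifold (𝓡 (d + 1)) ∞ M] {S : Spacetime d M}

/-- The points of a timelike curve shortly before or after the parameter `t₀` are joined to all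
points near `γ t₀` by timelike curves. -/
lemma IsConeCurve.eventually_timelikeStep {γ : ℝ → M} (hγ : IsConeCurve S.FutureTimelike γ) {t₀ : ℝ}
    (ht₀ : t₀ ∈ Icc (0 : ℝ) 1) :
    ∀ᶠ t in 𝓝[Icc (0 : ℝ) 1 \ {t₀}] t₀,
      (t < t₀ → ∀ᶠ y in 𝓝 (γ t₀), S.TimelikeStep (γ t) y) ∧
      (t₀ < t → ∀ᶠ y in 𝓝 (γ t₀), S.TimelikeStep y (γ t)) := by
  obtain ⟨U, hU, W, hW, hvW, hstep⟩ := exists_timelikeStep (hγ.2 t₀ ht₀)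
  set e := extChartAt (𝓡 (d + 1)) (γ t₀) with he
  have hmd := ((hγ.1 t₀ ht₀).mdifferentiableWithinAt one_ne_zero).hasMFDerivWithinAt
  have hslope := hasDerivWithinAt_iff_tendsto_slope.1 (hasDerivWithinAt_extChartAt_comp hmd)
  have h1 : ∀ᶠ t in 𝓝[Icc (0 : ℝ) 1 \ {t₀}] t₀, slope (fun u ↦ e (γ u)) t₀ t ∈ W :=
    hslope.eventually (hW.mem_nhds hvW)
  have h2 : ∀ᶠ t in 𝓝[Icc (0 : ℝ) 1 \ {t₀}] t₀, γ t ∈ U :=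
    ((hγ.1 t₀ ht₀).continuousWithinAt.mono sdiff_subset).eventually hU
  have hcont : ContinuousAt e (γ t₀) := continuousAt_extChartAt (γ t₀)
  filter_upwards [h1, h2] with t ht1 ht2
  rw [slope_def_module] at ht1
  refine ⟨fun hlt ↦ ?_, fun hlt ↦ ?_⟩
  · have hc : ContinuousAt (fun y ↦ (t₀ - t)⁻¹ • (e y - e (γ t))) (γ t₀) := by fun_prop
    have hmem : (t₀ - t)⁻¹ • (e (γ t₀) - e (γ t)) ∈ W := by
      rwa [← neg_sub t t₀, ← neg_sub (e (γ t)), inv_neg, neg_smul_neg]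
    filter_upwards [hU, hc.eventually_mem (hW.mem_nhds hmem)] with y hyU hyW
    exact hstep _ ht2 _ hyU _ (sub_pos.2 hlt) hyW
  · have hc : ContinuousAt (fun y ↦ (t - t₀)⁻¹ • (e (γ t) - e y)) (γ t₀) := by fun_prop
    filter_upwards [hU, hc.eventually_mem (hW.mem_nhds ht1)] with y hyU hyW
    exact hstep _ hyU _ ht2 _ (sub_pos.2 hlt) hyW

lemma TimelikeStep.eventually_right {x y : M} (h : S.TimelikeStep x y) :
    ∀ᶠ y' in 𝓝 y, S.ChronLT x y' := by
  obtain ⟨γ, hγ, rfl, rfl⟩ := timelikeStep_iff.1 h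
  have h1 := (hγ.eventually_timelikeStep (t₀ := 1) (by simp)).filter_mono
    (nhdsWithin_mono _ (show Ioo (0 : ℝ) 1 ⊆ Icc 0 1 \ {1} from
      fun t ht ↦ ⟨Ioo_subset_Icc_self ht, ht.2.ne⟩))
  have : (𝓝[Ioo (0 : ℝ) 1] 1).NeBot := right_nhdsWithin_Ioo_neBot zero_lt_one
  obtain ⟨t, ht, ht0, ht1⟩ := (h1.and self_mem_nhdsWithin).exists
  filter_upwards [ht.1 ht1] with y hy
  exact (hγ.timelikeStep le_rfl ht0 ht1.le).chronLT.tail hy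

lemma TimelikeStep.eventually_left {x y : M} (h : S.TimelikeStep x y) :
    ∀ᶠ x' in 𝓝 x, S.ChronLT x' y := by
  obtain ⟨γ, hγ, rfl, rfl⟩ := timelikeStep_iff.1 h
  have h1 := (hγ.eventually_timelikeStep (t₀ := 0) (by simp)).filter_mono
    (nhdsWithin_mono _ (show Ioo (0 : ℝ) 1 ⊆ Icc 0 1 \ {0} from
      fun t ht ↦ ⟨Ioo_subset_Icc_self ht, ht.1.ne'⟩))
  have : (𝓝[Ioo (0 : ℝ) 1] 0).NeBot := left_nhdsWithin_Ioo_neBot zero_lt_one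
  obtain ⟨t, ht, ht0, ht1⟩ := (h1.and self_mem_nhdsWithin).exists
  filter_upwards [ht.2 ht0] with x hx
  exact hx.chronLT.tail (hγ.timelikeStep ht0.le ht1 le_rfl)

lemma ChronLT.eventually_right {x y : M} (h : S.ChronLT x y) : ∀ᶠ y' in 𝓝 y, S.ChronLT x y' := by
  cases h with
  | single h => exact h.eventually_right
  | tail h h' => exact h'.eventually_right.mono fun _ h'' ↦ Relation.TransGen.trans h h''

lemma ChronLT.eventually_left {x y : M} (h : S.ChronLT x y) : ∀ᶠ x' in 𝓝 x, S.ChronLT x' y := by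
  rcases Relation.TransGen.head'_iff.1 h with ⟨z, h, h'⟩
  exact h.eventually_left.mono fun _ h'' ↦ Relation.TransGen.trans_left h'' h'

variable (S) in
lemma frequently_chronLT_right (p : M) : ∃ᶠ q in 𝓝 p, S.ChronLT p q := by
  obtain ⟨U, hU, W, hW, hvW, hstep⟩ := exists_timelikeStep (S := S) (p := p) futureTimelike_time
  set e := extChartAt (𝓡 (d + 1)) p with he
  refine Filter.Tendsto.frequently (l₁ := 𝓝[>] (0 : ℝ))
    ((tendsto_coordLine p (S.time p)).mono_left nhdsWithin_le_nhds)
    (Filter.Eventually.frequently ?_)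
  filter_upwards [nhdsWithin_le_nhds (eventually_extChartAt_coordLine p (S.time p)),
    nhdsWithin_le_nhds ((tendsto_coordLine p (S.time p)).eventually hU),
    self_mem_nhdsWithin] with s hs hsU (hs0 : 0 < s)
  refine (hstep _ (mem_of_mem_nhds hU) _ hsU s hs0 ?_).chronLT
  rw [he, hs, add_sub_cancel_left]
  exact (inv_smul_smul₀ hs0.ne' (S.time p : EuclideanSpace ℝ (Fin (d + 1)))).symm ▸ hvW

variable (S) in
lemma frequently_chronLT_left (p : M) : ∃ᶠ q in 𝓝 p, S.ChronLT q p := by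
  obtain ⟨U, hU, W, hW, hvW, hstep⟩ := exists_timelikeStep (S := S) (p := p) futureTimelike_time
  set e := extChartAt (𝓡 (d + 1)) p with he
  refine Filter.Tendsto.frequently (l₁ := 𝓝[<] (0 : ℝ))
    ((tendsto_coordLine p (S.time p)).mono_left nhdsWithin_le_nhds)
    (Filter.Eventually.frequently ?_)
  filter_upwards [nhdsWithin_le_nhds (eventually_extChartAt_coordLine p (S.time p)),
    nhdsWithin_le_nhds ((tendsto_coordLine p (S.time p)).eventually hU),
    self_mem_nhdsWithin] with s hs hsU (hs0 : s < 0)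
  refine (hstep _ hsU _ (mem_of_mem_nhds hU) (-s) (neg_pos.2 hs0) ?_).chronLT
  rw [he, hs, sub_add_cancel_left, inv_neg, neg_smul_neg]
  exact (inv_smul_smul₀ hs0.ne (S.time p : EuclideanSpace ℝ (Fin (d + 1)))).symm ▸ hvW

lemma ChronLT.eventually_prod {x y : M} (h : S.ChronLT x y) :
    ∀ᶠ z in 𝓝 (x, y), S.ChronLT z.1 z.2 := by
  obtain ⟨w, hxw, hwy⟩ := ((S.frequently_chronLT_right x).and_eventually
    h.eventually_left).exists
  rw [nhds_prod_eq]
  exact (hxw.eventually_left.prod_mk hwy.eventually_right).mono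
    fun z hz ↦ Relation.TransGen.trans hz.1 hz.2

/-! ### Closedness of the causal relation -/

/-- In a globally hyperbolic spacetime the causal relation is closed. If pairs `x ≤ y` accumulate at
`(p, q)`, then `p' ≤ q` for every `p' ≪ p`, since `q` lies in the closure of a compact diamond
`J⁺(p') ∩ J⁻(q')`; now let `p'` tend to `p` inside a diamond with future end point `q`. -/
lemma isClosed_causalLE [T2Space M] (hS : S.GloballyHyperbolic) :
    IsClosed {z : M × M | S.CausalLE z.1 z.2} := by
  rw [isClosed_iff_frequently]
  rintro ⟨p, q⟩ hpq
  have h1 : ∀ p', S.ChronLT p' p → S.CausalLE p' q := by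
    intro p' hp'
    obtain ⟨q', hq'⟩ := (S.frequently_chronLT_right q).exists
    have hcl := (hS.2 p' q').isClosed
    refine (isClosed_iff_frequently.1 hcl q ?_).1
    have hev : ∀ᶠ z in 𝓝 (p, q), S.ChronLT p' z.1 ∧ S.ChronLT z.2 q' := by
      rw [nhds_prod_eq]
      exact hp'.eventually_right.prod_mk hq'.eventually_left
    refine (continuous_snd.tendsto (p, q)).frequently ((hpq.and_eventually hev).mono ?_)
    rintro ⟨x, y⟩ ⟨hxy, hx, hy⟩
    exact ⟨hx.causalLE.trans hxy, hy.causalLE⟩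
  obtain ⟨p₀, hp₀⟩ := (S.frequently_chronLT_left p).exists
  refine (isClosed_iff_frequently.1 (hS.2 p₀ q).isClosed p ?_).2
  exact ((S.frequently_chronLT_left p).and_eventually hp₀.eventually_right).mono
    fun p' hp' ↦ ⟨hp'.2.causalLE, h1 p' hp'.1⟩

lemma isOpen_spacelikeSeparated [T2Space M] (hS : S.GloballyHyperbolic) :
    IsOpen {z : M × M | S.SpacelikeSeparated z.1 z.2} :=
  (isClosed_causalLE hS).isOpen_compl.inter
    ((isClosed_causalLE hS).preimage continuous_swap).isOpen_compl

lemma SpacelikeSeparated.ne {x y : M} (h : S.SpacelikeSeparated x y) : x ≠ y := by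
  rintro rfl
  exact h.1 Relation.ReflTransGen.refl

/-- A pair of distinct points that is a limit of spacelike separated pairs without being one
is null separated. -/
lemma nullSeparated_of_frequently {x y : M} (hne : x ≠ y) (h : ¬ S.SpacelikeSeparated x y)
    (hf : ∃ᶠ z in 𝓝 (x, y), S.SpacelikeSeparated z.1 z.2) : S.NullSeparated x y := by
  refine ⟨hne, by unfold SpacelikeSeparated at h; tauto, fun hc ↦ ?_, fun hc ↦ ?_⟩
  · obtain ⟨z, hz, hz'⟩ := (hf.and_eventually hc.eventually_prod).exists
    exact hz.1 hz'.causalLE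
  · have := (continuous_swap.tendsto (x, y)).eventually hc.eventually_prod
    obtain ⟨z, hz, hz'⟩ := (hf.and_eventually this).exists
    exact hz.2 hz'.causalLE

/-! ### Spacelike directions lead to spacelike separated points -/

/-- The velocity of a causal curve, in the coordinates of the chart at `p`. -/
lemma IsConeCurve.exists_hasDerivWithinAt {γ : ℝ → M} (hγ : IsConeCurve S.FutureCausal γ) {p : M}
    {t : ℝ} (hγs : ∀ t ∈ Icc (0 : ℝ) 1, γ t ∈ (extChartAt (𝓡 (d + 1)) p).source)
    (ht : t ∈ Icc (0 : ℝ) 1) :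
    ∃ w, HasDerivWithinAt (fun t ↦ extChartAt (𝓡 (d + 1)) p (γ t)) w (Icc 0 1) t ∧
      S.FutureCausal _ (chartVec p (extChartAt (𝓡 (d + 1)) p (γ t)) w) := by
  set e := extChartAt (𝓡 (d + 1)) p with he
  have hopen : IsOpen e.target := isOpen_extChartAt_target p
  have hc : ContMDiffOn 𝓘(ℝ, ℝ) 𝓘(ℝ, EuclideanSpace ℝ (Fin (d + 1))) 1
      (fun t ↦ e (γ t)) (Icc 0 1) :=
    (contMDiffOn_extChartAt (I := 𝓡 (d + 1)) (n := 1)).comp hγ.1 fun t ht ↦ by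
      simpa only [he, extChartAt_source, mem_preimage] using hγs t ht
  have hcd : DifferentiableWithinAt ℝ (fun t ↦ e (γ t)) (Icc 0 1) t :=
    (contMDiffOn_iff_contDiffOn.1 hc).differentiableOn one_ne_zero t ht
  refine ⟨derivWithin (fun t ↦ e (γ t)) (Icc 0 1) t, hcd.hasDerivWithinAt, ?_⟩
  have huniq := (uniqueDiffOn_Icc (zero_lt_one' ℝ)).uniqueMDiffOn t ht
  have h1 : HasMFDerivAt 𝓘(ℝ, EuclideanSpace ℝ (Fin (d + 1))) (𝓡 (d + 1)) e.symm (e (γ t)) _ :=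
    ((contMDiffOn_extChartAt_symm (n := ∞) p).contMDiffAt
      (hopen.mem_nhds (e.map_source (hγs t ht))) |>.mdifferentiableAt (by simp)).hasMFDerivAt
  have h2 := (h1.comp_hasMFDerivWithinAt t
    hcd.hasDerivWithinAt.hasFDerivWithinAt.hasMFDerivWithinAt).mfderivWithin huniq
  have h3 : mfderivWithin 𝓘(ℝ, ℝ) (𝓡 (d + 1)) γ (Icc 0 1) t =
      mfderivWithin 𝓘(ℝ, ℝ) (𝓡 (d + 1)) (e.symm ∘ fun t ↦ e (γ t)) (Icc 0 1) t :=
    mfderivWithin_congr (fun s hs ↦ (e.left_inv (hγs s hs)).symm) (e.left_inv (hγs t ht)).symm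
  have h4 : (mfderivWithin 𝓘(ℝ, ℝ) (𝓡 (d + 1)) γ (Icc 0 1) t (1 : ℝ) :
      EuclideanSpace ℝ (Fin (d + 1))) =
      chartVec p (e (γ t)) (derivWithin (fun t ↦ e (γ t)) (Icc 0 1) t) := by
    rw [h3, h2]
    exact congrArg (mfderiv 𝓘(ℝ, EuclideanSpace ℝ (Fin (d + 1))) (𝓡 (d + 1)) e.symm
        (e (γ t))) (one_smul ℝ (derivWithin (fun t ↦ e (γ t)) (Icc 0 1) t))
  have key : ∀ q q', q' = q → ∀ v w : EuclideanSpace ℝ (Fin (d + 1)), v = w →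
    S.FutureCausal q v → S.FutureCausal q' w := by rintro q _ rfl v _ rfl h; exact h
  exact key _ _ (e.left_inv (hγs t ht)) _ _ h4 (hγ.2 t ht)

/-- For a future timelike vector `u` at `p`, the linear function `g_p(u, ·)` of the coordinates
strictly decreases along causal curves near `p`: it is negative on the causal cone at `p`, hence also
on the nearby cones. -/
lemma exists_nhds_lt_of_futureTimelike {p : M} {u : TangentSpace (𝓡 (d + 1)) p}
    (hu : S.FutureTimelike p u) :
    ∃ V ∈ 𝓝 p, ∀ γ, IsConeCurve S.FutureCausal γ → (∀ t ∈ Icc (0 : ℝ) 1, γ t ∈ V) →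
      S.metric p u (extChartAt (𝓡 (d + 1)) p (γ 1) : EuclideanSpace ℝ (Fin (d + 1))) <
        S.metric p u (extChartAt (𝓡 (d + 1)) p (γ 0) : EuclideanSpace ℝ (Fin (d + 1))) := by
  set e := extChartAt (𝓡 (d + 1)) p with he
  set ℓ : EuclideanSpace ℝ (Fin (d + 1)) →L[ℝ] ℝ := S.metric p u with hℓ
  -- By compactness of the unit sphere, `ℓ` is negative on the causal cones near `p`.
  have hK : ∀ w ∈ Metric.sphere (0 : EuclideanSpace ℝ (Fin (d + 1))) 1,
      ∀ᶠ z in 𝓝 (e p, w),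
        0 < S.metric _ (chartVec p z.1 z.2) (chartVec p z.1 z.2) ∨
          0 < S.metric _ (chartVec p z.1 z.2) (S.time _) ∨ ℓ z.2 < 0 := by
    intro w hw
    have hmem : (e.target ×ˢ univ : Set (EuclideanSpace ℝ (Fin (d + 1)) ×
        EuclideanSpace ℝ (Fin (d + 1)))) ∈ 𝓝 (e p, w) :=
      ((isOpen_extChartAt_target p).prod isOpen_univ).mem_nhds
        ⟨mem_extChartAt_target p, mem_univ _⟩
    by_cases h1 : 0 < S.metric p w w
    · exact (continuousAt_const.eventually_lt
        ((S.continuousOn_metric_chartVec p).continuousAt hmem)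
        (h1.trans_eq (S.metric_chartVec_self p w w).symm)).mono fun _ h ↦ .inl h
    by_cases h2 : 0 < S.metric p w (S.time p)
    · exact (continuousAt_const.eventually_lt
        ((S.continuousOn_metric_chartVec_time p).continuousAt hmem)
        (h2.trans_eq (S.metric_chartVec_self_time p w).symm)).mono fun _ h ↦ .inr (.inl h)
    have h3 : ℓ w < 0 := by
      obtain ⟨b, hb⟩ := S.exists_isLorentzBasis p
      have hw0 : w ≠ 0 := by
        rintro rfl
        simp at hw
      exact (S.symm p u w).trans_lt (hb.neg_of_causal (S.symm p) (S.time_timelike p) hu.1 hu.2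
        (w := w) hw0 (not_lt.1 h1) (not_lt.1 h2))
    have hcont : ContinuousAt (fun z : EuclideanSpace ℝ (Fin (d + 1)) ×
        EuclideanSpace ℝ (Fin (d + 1)) ↦ ℓ z.2) (e p, w) := by fun_prop
    exact (hcont.eventually_lt continuousAt_const h3).mono fun _ h ↦ .inr (.inr h)
  have hB := (isCompact_sphere _ _).eventually_forall_of_forall_eventually
    (P := fun y w ↦ 0 < S.metric _ (chartVec p y w) (chartVec p y w) ∨
      0 < S.metric _ (chartVec p y w) (S.time _) ∨ ℓ w < 0) hK
  refine ⟨e.source ∩ e ⁻¹' {y | _}, Filter.inter_mem (extChartAt_source_mem_nhds p)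
      ((continuousAt_extChartAt p).preimage_mem_nhds hB), fun γ hγ hγV ↦ ?_⟩
  have hpos : ∀ t ∈ Icc (0 : ℝ) 1, ∃ c < 0,
      HasDerivWithinAt (fun t ↦ ℓ (e (γ t))) c (Icc 0 1) t := by
    intro t ht
    obtain ⟨w, hw, hwc⟩ := hγ.exists_hasDerivWithinAt (fun t ht ↦ (hγV t ht).1) ht
    refine ⟨ℓ w, ?_, ℓ.hasFDerivAt.comp_hasDerivWithinAt t hw⟩
    have hw0 : w ≠ 0 := by
      rintro rfl
      have h := hwc.2
      rw [show chartVec p (e (γ t)) 0 = 0 from map_zero _, map_zero] at h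
      exact lt_irrefl (0 : ℝ) h
    have hn : 0 < ‖w‖⁻¹ := inv_pos.2 (norm_pos_iff.2 hw0)
    have h := (hγV t ht).2 (‖w‖⁻¹ • w) (by simp [norm_smul, hw0])
    have hc := hwc.smul hn
    rw [← chartVec_smul] at hc
    rcases h with h | h | h
    · exact absurd h (not_lt.2 hc.1)
    · exact absurd h (not_lt.2 hc.2.le)
    · rw [map_smul, smul_eq_mul] at h
      exact (pos_iff_neg_of_mul_neg h).1 hn
  have hanti : StrictAntiOn (fun t ↦ ℓ (e (γ t))) (Icc 0 1) := by
    refine strictAntiOn_of_deriv_neg (convex_Icc 0 1)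
      (fun t ht ↦ (hpos t ht).choose_spec.2.continuousWithinAt) fun t ht ↦ ?_
    rw [interior_Icc] at ht
    obtain ⟨c, hc, hd⟩ := hpos t (Ioo_subset_Icc_self ht)
    rwa [(hd.hasDerivAt (Icc_mem_nhds ht.1 ht.2)).deriv]
  exact hanti (by simp) (by simp) zero_lt_one

/-- In a strongly causal spacetime, straight coordinate lines in a spacelike direction `v` at `p`
lead to points spacelike separated from `p`. A future timelike vector `u` orthogonal to `v` provides
a coordinate function that is constant along the line, but monotone along causal curves. -/
lemma eventually_spacelikeSeparated (hS : S.StronglyCausal) {p : M}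
    {v : TangentSpace (𝓡 (d + 1)) p} (hv : 0 < S.metric p v v) :
    ∀ᶠ s : ℝ in 𝓝[>] 0, S.SpacelikeSeparated p (coordLine p v s) := by
  set a := S.metric p (S.time p) v / S.metric p v v with ha
  set u := S.time p - a • v with hu
  have hav : a * S.metric p v v = S.metric p (S.time p) v := div_mul_cancel₀ _ hv.ne'
  have huv : S.metric p u v = 0 := by
    simp only [hu, map_sub, map_smul, sub_apply, smul_apply, smul_eq_mul, hav, sub_self]
  have huT : S.metric p u (S.time p) < 0 := by
    simp only [hu, map_sub, map_smul, sub_apply, smul_apply, smul_eq_mul, S.symm p v (S.time p),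
      ← hav]
    nlinarith [S.time_timelike p, mul_nonneg (mul_self_nonneg a) hv.le]
  have hut : S.FutureTimelike p u := by
    refine ⟨?_, huT⟩
    have : S.metric p u u = S.metric p u (S.time p) := by
      conv_lhs => rw [hu, map_sub, map_smul, ← hu, huv]
      simp
    rwa [this]
  obtain ⟨V, hV, hVγ⟩ := exists_nhds_lt_of_futureTimelike hut
  obtain ⟨V', hV', -, hV'V⟩ := hS p V hV
  let v' : EuclideanSpace ℝ (Fin (d + 1)) := v
  let ℓ : EuclideanSpace ℝ (Fin (d + 1)) →L[ℝ] ℝ := S.metric p u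
  have hℓv : ℓ v' = 0 := huv
  let e := extChartAt (𝓡 (d + 1)) p
  have hmono : ∀ x ∈ V', ∀ y ∈ V', ∀ z, S.CausalLE x z → S.CausalLE z y → x = z ∨ ℓ (e z) < ℓ (e x) := by
    intro x hx y hy z hxz
    induction hxz with
    | refl => exact fun _ ↦ .inl rfl
    | @tail z w hxz hzw ih =>
      intro hwy
      obtain ⟨γ, hγ, rfl, rfl⟩ := causalStep_iff.1 hzw
      have hlt := hVγ γ hγ fun t ht ↦ hV'V x hx y hy _
        (hxz.trans (hγ.causalLE le_rfl ht.1 ht.2)) ((hγ.causalLE ht.1 ht.2 le_rfl).trans hwy)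
      rcases ih ((Relation.ReflTransGen.single hzw).trans hwy) with h | h
      · exact .inr (h ▸ hlt)
      · exact .inr (hlt.trans h)
  filter_upwards [nhdsWithin_le_nhds (eventually_extChartAt_coordLine p v'),
    nhdsWithin_le_nhds ((tendsto_coordLine p v').eventually hV'),
    self_mem_nhdsWithin] with s hs hsV (hs0 : 0 < s)
  have hpV := mem_of_mem_nhds hV'
  have heq : ℓ (e (coordLine p v' s)) = ℓ (e p) := by
    rw [hs, map_add, map_smul, hℓv, smul_zero, add_zero]
  have hne : p ≠ coordLine p v' s := by
    intro h
    rw [← h, left_eq_add, smul_eq_zero] at hs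
    rcases hs with h | h
    · exact hs0.ne' h
    · have h' : v = 0 := h
      simp [h'] at hv
  refine ⟨fun h ↦ ?_, fun h ↦ ?_⟩
  · exact (hmono p hpV _ hsV _ h .refl).elim hne fun h ↦ h.ne heq
  · exact (hmono _ hsV p hpV p h .refl).elim hne.symm fun h ↦ h.ne heq.symm

/-! ### Maps preserving spacelike separation are conformal -/

omit [IsManifold (𝓡 (d + 1)) ∞ M] in
/-- The differential of `f` at `p`, as the velocity of the image of a straight coordinate line. -/
lemma hasDerivAt_extChartAt_comp_coordLine {f : M → M} {p : M}
    (hf : MDifferentiableAt (𝓡 (d + 1)) (𝓡 (d + 1)) f p) (v : TangentSpace (𝓡 (d + 1)) p) :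
    HasDerivAt (fun s ↦ extChartAt (𝓡 (d + 1)) (f p) (f (coordLine p v s)))
      (mfderiv (𝓡 (d + 1)) (𝓡 (d + 1)) f p v : EuclideanSpace ℝ (Fin (d + 1))) 0 := by
  let v' : EuclideanSpace ℝ (Fin (d + 1)) := v
  let D : EuclideanSpace ℝ (Fin (d + 1)) →L[ℝ] EuclideanSpace ℝ (Fin (d + 1)) :=
    mfderiv (𝓡 (d + 1)) (𝓡 (d + 1)) f p
  have h1 : HasFDerivWithinAt (writtenInExtChartAt (𝓡 (d + 1)) (𝓡 (d + 1)) p f) D univ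
      (extChartAt (𝓡 (d + 1)) p p) := by
    have h := hf.hasMFDerivAt.2
    rwa [modelWithCornersSelf_coe, range_id] at h
  rw [hasFDerivWithinAt_univ] at h1
  have h2 : HasDerivAt (fun s : ℝ ↦ extChartAt (𝓡 (d + 1)) p p + s • v') v' 0 := by
    simpa using ((hasDerivAt_id (0 : ℝ)).smul_const v').const_add (extChartAt (𝓡 (d + 1)) p p)
  exact HasFDerivAt.comp_hasDerivAt 0 (l' := D) (by simpa using h1) h2

/-- If `f` preserves spacelike separation from `p`, then its differential does not map spacelike
vectors at `p` to timelike vectors. -/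
lemma metric_mfderiv_nonneg (hS : S.StronglyCausal) {f : M → M} {p : M}
    (hf : MDifferentiableAt (𝓡 (d + 1)) (𝓡 (d + 1)) f p)
    (hsep : ∀ᶠ x in 𝓝 p, S.SpacelikeSeparated p x → S.SpacelikeSeparated (f p) (f x))
    {v : TangentSpace (𝓡 (d + 1)) p} (hv : 0 < S.metric p v v) :
    0 ≤ S.metric (f p) (mfderiv (𝓡 (d + 1)) (𝓡 (d + 1)) f p v)
      (mfderiv (𝓡 (d + 1)) (𝓡 (d + 1)) f p v) := by
  by_contra! hneg
  have hline := (tendsto_coordLine p v).mono_left (nhdsWithin_le_nhds (s := Ioi (0 : ℝ)))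
  have hflim := hf.continuousAt.tendsto.comp hline
  have hslope := hasDerivWithinAt_iff_tendsto_slope.1
    ((hasDerivAt_extChartAt_comp_coordLine hf v).hasDerivWithinAt (s := Ioi 0))
  rw [sdiff_singleton_eq_self self_notMem_Ioi] at hslope
  have h0 : coordLine p v 0 = p := coordLine_zero p v
  -- Otherwise `f p` and the images of nearby spacelike separated points are joined by
  -- timelike curves.
  rcases futureTimelike_or_neg hneg with h | h
  · obtain ⟨U, hU, W, hW, hvW, hstep⟩ := exists_timelikeStep h
    obtain ⟨s, h1, h2, h3, h4, hs⟩ := ((hslope.eventually (hW.mem_nhds hvW)).and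
      ((hflim.eventually hU).and ((hline.eventually hsep).and
        ((eventually_spacelikeSeparated hS hv).and self_mem_nhdsWithin)))).exists
    rw [slope_def_module, sub_zero, h0] at h1
    exact (h3 h4).1 (hstep _ (mem_of_mem_nhds hU) _ h2 s hs h1).causalLE
  · obtain ⟨U, hU, W, hW, hvW, hstep⟩ := exists_timelikeStep h
    obtain ⟨s, h1, h2, h3, h4, hs⟩ := ((hslope.neg.eventually (hW.mem_nhds hvW)).and
      ((hflim.eventually hU).and ((hline.eventually hsep).and
        ((eventually_spacelikeSeparated hS hv).and self_mem_nhdsWithin)))).exists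
    rw [slope_def_module, sub_zero, h0, ← smul_neg, neg_sub] at h1
    exact (h3 h4).2 (hstep _ h2 _ (mem_of_mem_nhds hU) s hs h1).causalLE

variable (S) in
/-- The factor by which `f` scales the squared length of the time orientation at `p`. If `f` is
conformal, this is the square of its conformal factor. -/
def scaling (f : M → M) (p : M) : ℝ :=
  S.metric (f p) (mfderiv (𝓡 (d + 1)) (𝓡 (d + 1)) f p (S.time p))
    (mfderiv (𝓡 (d + 1)) (𝓡 (d + 1)) f p (S.time p)) / S.metric p (S.time p) (S.time p)

/-- Locally invertible maps preserving spacelike separation from a point in both directions are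
conformal there. -/
lemma metric_mfderiv_eq_scaling (hS : S.StronglyCausal) {f k : M → M} {p : M}
    (hf : MDifferentiableAt (𝓡 (d + 1)) (𝓡 (d + 1)) f p)
    (hk : MDifferentiableAt (𝓡 (d + 1)) (𝓡 (d + 1)) k (f p))
    (hkf : ∀ᶠ x in 𝓝 p, k (f x) = x) (hfk : ∀ᶠ y in 𝓝 (f p), f (k y) = y)
    (hfsep : ∀ᶠ x in 𝓝 p, S.SpacelikeSeparated p x → S.SpacelikeSeparated (f p) (f x))
    (hksep : ∀ᶠ y in 𝓝 (f p), S.SpacelikeSeparated (f p) y → S.SpacelikeSeparated p (k y)) :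
    0 < S.scaling f p ∧ ∀ v w, S.metric (f p) (mfderiv (𝓡 (d + 1)) (𝓡 (d + 1)) f p v)
      (mfderiv (𝓡 (d + 1)) (𝓡 (d + 1)) f p w) = S.scaling f p * S.metric p v w := by
  set D := mfderiv (𝓡 (d + 1)) (𝓡 (d + 1)) f p with hD
  set D' := mfderiv (𝓡 (d + 1)) (𝓡 (d + 1)) k (f p) with hD'
  have hp : k (f p) = p := hkf.self_of_nhds
  have hD'D : ∀ v : TangentSpace (𝓡 (d + 1)) p, (D' (D v) : EuclideanSpace ℝ (Fin (d + 1))) = v := by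
    intro v
    have h1 := (hk.hasMFDerivAt.comp p hf.hasMFDerivAt).congr_of_eventuallyEq
      (f₁ := id) (hkf.mono fun x hx ↦ hx.symm)
    exact DFunLike.congr_fun (hasMFDerivAt_unique h1 (hasMFDerivAt_id p)) v
  have hDD' : ∀ w : TangentSpace (𝓡 (d + 1)) (f p), ∃ v : TangentSpace (𝓡 (d + 1)) p, D v = w := by
    intro w
    have h0 : HasMFDerivAt (𝓡 (d + 1)) (𝓡 (d + 1)) f (k (f p)) (D : _ →L[ℝ] _) := by
      rw [hp]
      exact hf.hasMFDerivAt
    have h1 := (h0.comp (f p) hk.hasMFDerivAt).congr_of_eventuallyEq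
      (f₁ := id) (hfk.mono fun x hx ↦ hx.symm)
    exact ⟨D' w, DFunLike.congr_fun (hasMFDerivAt_unique h1 (hasMFDerivAt_id (f p))) w⟩
  have key : ∀ q, q = p → ∀ v w : EuclideanSpace ℝ (Fin (d + 1)), v = w →
    S.metric q v v = S.metric p w w := by rintro _ rfl v _ rfl; rfl
  let h : TangentSpace (𝓡 (d + 1)) p →ₗ[ℝ] TangentSpace (𝓡 (d + 1)) p →ₗ[ℝ] ℝ :=
    LinearMap.mk₂ ℝ (fun v w ↦ S.metric (f p) (D v) (D w)) (by simp) (by simp) (by simp) (by simp)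
  obtain ⟨b, hb⟩ := S.exists_isLorentzBasis p
  obtain ⟨c, hc, hch⟩ := hb.exists_eq_smul (h := h) (S.symm p) (fun v w ↦ S.symm (f p) _ _)
    (fun v hv ↦ metric_mfderiv_nonneg hS hf hfsep hv) (by
      intro v hv
      by_contra! hpos
      have h1 := metric_mfderiv_nonneg hS hk (by simpa only [hp] using hksep) hpos
      rw [← hD', key _ hp _ _ (hD'D v)] at h1
      exact absurd hv (not_lt.2 h1))
  have hc0 : c ≠ 0 := by
    rintro rfl
    obtain ⟨v, hv⟩ := hDD' (S.time (f p))
    have h1 := hch v v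
    have h2 := S.time_timelike (f p)
    rw [zero_mul] at h1
    rw [← hv] at h2
    exact h2.ne h1
  have hcs : c = S.scaling f p := by
    rw [scaling, eq_div_iff (S.time_timelike p).ne]
    exact (hch _ _).symm
  exact ⟨hcs ▸ lt_of_le_of_ne hc hc0.symm, fun v w ↦ hcs ▸ hch v w⟩

/-- A vector field `V` on `M` and a constant vector field `a` on `ℝ` combine to a smooth vector
field on `ℝ × M`. -/
lemma contMDiff_prod_section {V : ∀ p : M, TangentSpace (𝓡 (d + 1)) p} (hV : ContMDiff (𝓡 (d + 1))
    (𝓡 (d + 1)).tangent ∞ (fun p ↦ (⟨p, V p⟩ : TangentBundle (𝓡 (d + 1)) M))) (a : ℝ) :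
    ContMDiff (𝓘(ℝ, ℝ).prod (𝓡 (d + 1))) (𝓘(ℝ, ℝ).prod (𝓡 (d + 1))).tangent ∞
      (fun z : ℝ × M ↦ (⟨z, (a, V z.2)⟩ :
        TangentBundle (𝓘(ℝ, ℝ).prod (𝓡 (d + 1))) (ℝ × M))) := by
  have : IsManifold (𝓡 (d + 1)) 1 M := .of_le (n := ∞) (by simp)
  have h1 : ContMDiff 𝓘(ℝ, ℝ) 𝓘(ℝ, ℝ).tangent ∞
      (fun t : ℝ ↦ (⟨t, a⟩ : TangentBundle 𝓘(ℝ, ℝ) ℝ)) := by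
    have h := (contMDiff_id (I := 𝓘(ℝ, ℝ)) (n := ∞) (M := ℝ)).prodMk
      (contMDiff_const (I := 𝓘(ℝ, ℝ)) (I' := 𝓘(ℝ, ℝ)) (M := ℝ) (c := a))
    rw [chartedSpaceSelf_prod] at h
    exact (contMDiff_tangentBundleModelSpaceHomeomorph_symm (I := 𝓘(ℝ, ℝ))).comp h
  exact contMDiff_equivTangentBundleProd_symm.comp
    ((h1.comp contMDiff_fst).prodMk (hV.comp contMDiff_snd))

/-- The scaling factors of a smooth family of maps are smooth. -/
lemma contMDiffOn_scaling {f : ℝ → M → M} {A : Set M} (hA : IsOpen A)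
    (hf : ContMDiffOn (𝓘(ℝ, ℝ).prod (𝓡 (d + 1))) (𝓡 (d + 1)) ∞
      (fun z : ℝ × M ↦ f z.1 z.2) (univ ×ˢ A)) :
    ContMDiffOn (𝓘(ℝ, ℝ).prod (𝓡 (d + 1))) 𝓘(ℝ, ℝ) ∞
      (fun z : ℝ × M ↦ S.scaling (f z.1) z.2) (univ ×ˢ A) := by
  have hsec : ContMDiffOn (𝓘(ℝ, ℝ).prod (𝓡 (d + 1))) (𝓘(ℝ, ℝ).prod (𝓡 (d + 1))).tangent ∞
      (fun z : ℝ × M ↦ (⟨z, ((0 : ℝ), S.time z.2)⟩ :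
        TangentBundle (𝓘(ℝ, ℝ).prod (𝓡 (d + 1))) (ℝ × M))) (univ ×ˢ A) :=
    (contMDiff_prod_section S.smooth_time 0).contMDiffOn
  have h1 := hf.mfderiv_section (isOpen_univ.prod hA) hsec fun z hz ↦ hz
  have h2 := S.contMDiffOn_metric h1 h1
  have hT := S.contMDiffOn_time_comp (contMDiffOn_snd
    (I := 𝓘(ℝ, ℝ)) (J := 𝓡 (d + 1)) (n := ∞) (M := ℝ) (N := M) (s := univ ×ˢ A))
  have h3 := S.contMDiffOn_metric hT hT
  refine (h2.div₀ h3 fun z _ ↦ (S.time_timelike z.2).ne).congr fun z hz ↦ ?_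
  have hz' : MDifferentiableAt (𝓘(ℝ, ℝ).prod (𝓡 (d + 1))) (𝓡 (d + 1))
      (fun z : ℝ × M ↦ f z.1 z.2) z :=
    (hf.contMDiffAt ((isOpen_univ.prod hA).mem_nhds hz)).mdifferentiableAt (by simp)
  have h4 : mfderiv (𝓘(ℝ, ℝ).prod (𝓡 (d + 1))) (𝓡 (d + 1)) (fun z : ℝ × M ↦ f z.1 z.2) z
      ((0 : ℝ), S.time z.2) = mfderiv (𝓡 (d + 1)) (𝓡 (d + 1)) (f z.1) z.2 (S.time z.2) := by
    refine (mfderiv_prod_eq_add_apply hz').trans ?_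
    exact (congrArg (· + _) (map_zero (mfderiv 𝓘(ℝ, ℝ) (𝓡 (d + 1)) (fun t ↦ f t z.2) z.1))).trans
      (zero_add _)
  simp only [scaling, Pi.div_apply, h4]

/-- A map that scales the metric pointwise, with positive factors, is conformal. -/
lemma conformalOn_of_scaling {A : Set M} (hA : IsOpen A) {f : M → M}
    (hf : ContMDiffOn (𝓡 (d + 1)) (𝓡 (d + 1)) ∞ f A)
    (h : ∀ p ∈ A, 0 < S.scaling f p ∧ ∀ v w, S.metric (f p)
      (mfderiv (𝓡 (d + 1)) (𝓡 (d + 1)) f p v) (mfderiv (𝓡 (d + 1)) (𝓡 (d + 1)) f p w) =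
        S.scaling f p * S.metric p v w) : S.ConformalOn A f := by
  refine ⟨fun p ↦ √(S.scaling f p), fun p hp ↦ ?_, fun p hp ↦ ⟨Real.sqrt_pos.2 (h p hp).1,
    fun v w ↦ ?_⟩⟩
  · have h1 : ContMDiffOn (𝓘(ℝ, ℝ).prod (𝓡 (d + 1))) 𝓘(ℝ, ℝ) ∞
        (fun z : ℝ × M ↦ S.scaling f z.2) (univ ×ˢ A) :=
      contMDiffOn_scaling (f := fun _ ↦ f) hA
        (hf.comp contMDiffOn_snd fun z (hz : z ∈ univ ×ˢ A) ↦ hz.2)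
    have h2 : ContMDiffOn (𝓡 (d + 1)) 𝓘(ℝ, ℝ) ∞ (S.scaling f) A :=
      h1.comp (contMDiffOn_const.prodMk contMDiffOn_id : ContMDiffOn (𝓡 (d + 1))
        (𝓘(ℝ, ℝ).prod (𝓡 (d + 1))) ∞ (fun p : M ↦ ((0 : ℝ), p)) A) fun p hp ↦ ⟨mem_univ _, hp⟩
    exact (Real.contDiffAt_sqrt (h p hp).1.ne').contMDiffAt.comp_contMDiffWithinAt p (h2 p hp)
  · rw [Real.sq_sqrt (h p hp).1.le, (h p hp).2]

/-- A diffeomorphism of an open set that preserves spacelike separation scales the metric. -/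
lemma metric_mfderiv_eq_scaling_of_forall (hS : S.StronglyCausal) {A : Set M} (hA : IsOpen A)
    {f k : M → M} (hf : ContMDiffOn (𝓡 (d + 1)) (𝓡 (d + 1)) ∞ f A)
    (hk : ContMDiffOn (𝓡 (d + 1)) (𝓡 (d + 1)) ∞ k A) (hfA : MapsTo f A A)
    (hkf : ∀ x ∈ A, k (f x) = x) (hkA : MapsTo k A A) (hfk : ∀ x ∈ A, f (k x) = x)
    (hsep : ∀ x ∈ A, ∀ y ∈ A, S.SpacelikeSeparated x y ↔ S.SpacelikeSeparated (f x) (f y))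
    {p : M} (hp : p ∈ A) :
    0 < S.scaling f p ∧ ∀ v w, S.metric (f p) (mfderiv (𝓡 (d + 1)) (𝓡 (d + 1)) f p v)
      (mfderiv (𝓡 (d + 1)) (𝓡 (d + 1)) f p w) = S.scaling f p * S.metric p v w := by
  have hpA : ∀ᶠ x in 𝓝 p, x ∈ A := hA.mem_nhds hp
  have hfpA : ∀ᶠ x in 𝓝 (f p), x ∈ A := hA.mem_nhds (hfA hp)
  refine metric_mfderiv_eq_scaling hS ((hf.contMDiffAt hpA).mdifferentiableAt (by simp))
    ((hk.contMDiffAt hfpA).mdifferentiableAt (by simp)) (hpA.mono hkf) (hfpA.mono hfk)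
    (hpA.mono fun x hx ↦ (hsep p hp x hx).1) (hfpA.mono fun y hy h ↦ ?_)
  rw [hsep p hp _ (hkA hy), hfk y hy]
  exact h

end Spacetime

/-! ### The conformal Killing equation -/

section Calculus

variable {E : Type*} [NormedAddCommGroup E] [NormedSpace ℝ E]

/-- The derivative of a family of symmetric bilinear forms is symmetric. -/
lemma fderiv_bilinear_symm {G : E → E →L[ℝ] E →L[ℝ] ℝ} {y₀ : E} (hG : DifferentiableAt ℝ G y₀)
    (hsymm : ∀ y a b, G y a b = G y b a) (u a b : E) :
    fderiv ℝ G y₀ u a b = fderiv ℝ G y₀ u b a := by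
  have h0 : ∀ a b, HasFDerivAt (fun y ↦ G y a b) (((fderiv ℝ G y₀).flip a).flip b) y₀ := by
    intro a b
    have h1 : HasFDerivAt (fun y ↦ G y a) ((fderiv ℝ G y₀).flip a) y₀ := by
      simpa using hG.hasFDerivAt.clm_apply (hasFDerivAt_const a y₀)
    simpa using h1.clm_apply (hasFDerivAt_const b y₀)
  have h1 := h0 a b
  simp only [hsymm _ a b] at h1
  exact DFunLike.congr_fun (h1.unique (h0 b a)) u

set_option synthInstance.maxHeartbeats 200000 in
/-- If the flow `F` scales the metric `G` by `c t`, then the Lie derivative of `G` along its generator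
`X y = ∂ₜ F (0, y)` is `c'(0) G`. -/
lemma lieDerivative_eq {G : E → E →L[ℝ] E →L[ℝ] ℝ} {F : ℝ × E → E} {y₀ v w : E} {c : ℝ → ℝ} {κ : ℝ}
    (hG : DifferentiableAt ℝ G y₀) (hF : ContDiffAt ℝ 2 F (0, y₀))
    (hF0 : ∀ᶠ y in 𝓝 y₀, F (0, y) = y) (hc : HasDerivAt c κ 0)
    (hid : ∀ᶠ t in 𝓝 (0 : ℝ), G (F (t, y₀)) (fderiv ℝ F (t, y₀) (0, v))
      (fderiv ℝ F (t, y₀) (0, w)) = c t * G y₀ v w) {X : E → E}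
    (hX : ∀ᶠ y in 𝓝 y₀, X y = fderiv ℝ F (0, y) (1, 0)) :
    fderiv ℝ G y₀ (X y₀) v w + G y₀ (fderiv ℝ X y₀ v) w + G y₀ v (fderiv ℝ X y₀ w) =
      κ * G y₀ v w := by
  have hd : DifferentiableAt ℝ (fderiv ℝ F) (0, y₀) :=
    (hF.fderiv_right (m := 1) (by norm_num)).differentiableAt one_ne_zero
  have hsymm : IsSymmSndFDerivAt ℝ F (0, y₀) := hF.isSymmSndFDerivAt (by simp)
  have hF1 : DifferentiableAt ℝ F (0, y₀) := hF.differentiableAt two_ne_zero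
  have hl : HasDerivAt (fun t : ℝ ↦ (t, y₀)) ((1 : ℝ), (0 : E)) 0 :=
    (hasDerivAt_id (0 : ℝ)).prodMk (hasDerivAt_const _ _)
  have hr : HasFDerivAt (fun y : E ↦ ((0 : ℝ), y)) (ContinuousLinearMap.inr ℝ ℝ E) y₀ :=
    hasFDerivAt_prodMk_right _ _
  have hX' : ∀ u, fderiv ℝ X y₀ u = fderiv ℝ (fderiv ℝ F) (0, y₀) (0, u) (1, 0) := by
    intro u
    rw [Filter.EventuallyEq.fderiv_eq hX]
    have h1 := (ContinuousLinearMap.apply ℝ E ((1 : ℝ), (0 : E))).hasFDerivAt.comp y₀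
      (hd.hasFDerivAt.comp y₀ hr)
    exact DFunLike.congr_fun h1.fderiv u
  have hFt : HasDerivAt (fun t ↦ F (t, y₀)) (X y₀) 0 := by
    rw [hX.self_of_nhds]
    exact hF1.hasFDerivAt.comp_hasDerivAt 0 hl
  have hF00 : F (0, y₀) = y₀ := hF0.self_of_nhds
  have hF0' : ∀ u, fderiv ℝ F (0, y₀) (0, u) = u := by
    intro u
    have h1 := (hF1.hasFDerivAt.comp y₀ hr).congr_of_eventuallyEq (f₁ := id)
      (hF0.mono fun y hy ↦ hy.symm)
    exact DFunLike.congr_fun (h1.unique (hasFDerivAt_id y₀)) u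
  have hD : ∀ u, HasDerivAt (fun t ↦ fderiv ℝ F (t, y₀) (0, u)) (fderiv ℝ X y₀ u) 0 := by
    intro u
    rw [hX', hsymm.eq]
    have h1 := hd.hasFDerivAt.comp_hasDerivAt 0 hl
    exact (ContinuousLinearMap.apply ℝ E ((0 : ℝ), u)).hasFDerivAt.comp_hasDerivAt 0 h1
  have hGt : HasDerivAt (fun t ↦ G (F (t, y₀))) (fderiv ℝ G y₀ (X y₀)) 0 := by
    have h1 : HasFDerivAt G (fderiv ℝ G y₀) (F (0, y₀)) := by rw [hF00]; exact hG.hasFDerivAt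
    exact HasFDerivAt.comp_hasDerivAt (E := E →L[ℝ] E →L[ℝ] ℝ) 0 h1 hFt
  have h1 := ((hGt.clm_apply (hD v)).clm_apply (hD w)).congr_of_eventuallyEq
    (f₁ := fun t ↦ c t * G y₀ v w) (hid.mono fun t ht ↦ ht.symm)
  have h2 := h1.unique (hc.mul_const (G y₀ v w))
  simpa only [hF00, hF0', add_apply] using h2

end Calculus

namespace Spacetime

variable {d : ℕ} {M : Type*} [TopologicalSpace M]
  [ChartedSpace (EuclideanSpace ℝ (Fin (d + 1))) M] [IsManifold (𝓡 (d + 1)) ∞ M]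
  {S : Spacetime d M}

/-- The metric in a chart, evaluated on the components of tangent vectors. -/
lemma metricInChart_mfderiv {p q : M} (hq : q ∈ (extChartAt (𝓡 (d + 1)) p).source)
    (v w : TangentSpace (𝓡 (d + 1)) q) :
    S.metricInChart p (extChartAt (𝓡 (d + 1)) p q)
      (mfderiv (𝓡 (d + 1)) 𝓘(ℝ, EuclideanSpace ℝ (Fin (d + 1))) (extChartAt (𝓡 (d + 1)) p) q v)
      (mfderiv (𝓡 (d + 1)) 𝓘(ℝ, EuclideanSpace ℝ (Fin (d + 1))) (extChartAt (𝓡 (d + 1)) p) q w) =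
      S.metric q v w := by
  have : IsManifold (𝓡 (d + 1)) 1 M := .of_le (n := ∞) (by simp)
  have h := mfderivWithin_extChartAt_symm_comp_mfderiv_extChartAt' (I := 𝓡 (d + 1)) hq
  rw [modelWithCornersSelf_coe, range_id, mfderivWithin_univ] at h
  have key : ∀ q', q' = q → ∀ a b a' b' : EuclideanSpace ℝ (Fin (d + 1)), a = a' → b = b' →
    S.metric q' a b = S.metric q a' b' := by rintro _ rfl a b _ _ rfl rfl; rfl
  exact key _ ((extChartAt (𝓡 (d + 1)) p).left_inv hq) _ _ _ _ (DFunLike.congr_fun h v)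
    (DFunLike.congr_fun h w)

/-- The symmetrized covariant derivative is the Lie derivative of the metric. -/
lemma covDeriv_add_covDeriv (ξ : ∀ q : M, TangentSpace (𝓡 (d + 1)) q) (p : M)
    (v w : EuclideanSpace ℝ (Fin (d + 1))) :
    S.covDeriv ξ p v w + S.covDeriv ξ p w v =
      fderiv ℝ (S.metricInChart p) (extChartAt (𝓡 (d + 1)) p p)
        (vectorInChart ξ p (extChartAt (𝓡 (d + 1)) p p)) v w +
      S.metricInChart p (extChartAt (𝓡 (d + 1)) p p)
        (fderiv ℝ (vectorInChart ξ p) (extChartAt (𝓡 (d + 1)) p p) v) w +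
      S.metricInChart p (extChartAt (𝓡 (d + 1)) p p) v
        (fderiv ℝ (vectorInChart ξ p) (extChartAt (𝓡 (d + 1)) p p) w) := by
  have hG : DifferentiableAt ℝ (S.metricInChart p) (extChartAt (𝓡 (d + 1)) p p) :=
    ((S.contDiffOn_metricInChart p).contDiffAt (extChartAt_target_mem_nhds p)).differentiableAt
      (by simp)
  have hsymm : ∀ y a b, S.metricInChart p y a b = S.metricInChart p y b a :=
    fun y a b ↦ S.symm _ _ _
  have hd := fderiv_bilinear_symm hG hsymm
  simp only [covDeriv]
  rw [hsymm _ v, hd v _ w, hd w v, hd _ w v]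
  ring

/-! ### Generators of conformal flows -/

/-- The time derivative at time `0` of a smooth map on `ℝ × A`, as a smooth vector field along
`A`. -/
lemma contMDiffOn_mfderiv_time {E' H' N : Type*} [NormedAddCommGroup E'] [NormedSpace ℝ E']
    [TopologicalSpace H'] {J : ModelWithCorners ℝ E' H'} [TopologicalSpace N]
    [ChartedSpace H' N] [IsManifold J ∞ N] {A : Set M} (hA : IsOpen A) {f : ℝ → M → N}
    (hf : ContMDiffOn (𝓘(ℝ, ℝ).prod (𝓡 (d + 1))) J ∞ (fun z : ℝ × M ↦ f z.1 z.2) (univ ×ˢ A)) :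
    ContMDiffOn (𝓡 (d + 1)) J.tangent ∞
      (fun p ↦ (⟨f 0 p, mfderiv 𝓘(ℝ, ℝ) J (fun t ↦ f t p) 0 (1 : ℝ)⟩ : TangentBundle J N)) A := by
  have hι : ContMDiffOn (𝓡 (d + 1)) (𝓘(ℝ, ℝ).prod (𝓡 (d + 1))) ∞ (fun p : M ↦ ((0 : ℝ), p)) A :=
    contMDiffOn_const.prodMk contMDiffOn_id
  have hsec := (contMDiff_prod_section (d := d) (M := M) (V := fun p ↦ 0)
    (contMDiff_zeroSection ℝ (TangentSpace (𝓡 (d + 1)) (M := M))) 1).comp_contMDiffOn hι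
  refine (hf.mfderiv_section (isOpen_univ.prod hA) hsec fun p hp ↦ ⟨mem_univ _, hp⟩).congr
    fun p hp ↦ ?_
  have hd : MDifferentiableAt (𝓘(ℝ, ℝ).prod (𝓡 (d + 1))) J (fun z : ℝ × M ↦ f z.1 z.2) (0, p) :=
    (hf.contMDiffAt ((isOpen_univ.prod hA).mem_nhds ⟨mem_univ _, hp⟩)).mdifferentiableAt (by simp)
  have h1 : mfderiv (𝓘(ℝ, ℝ).prod (𝓡 (d + 1))) J (fun z : ℝ × M ↦ f z.1 z.2) (0, p)
      ((1 : ℝ), (0 : TangentSpace (𝓡 (d + 1)) p)) =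
      mfderiv 𝓘(ℝ, ℝ) J (fun t ↦ f t p) 0 (1 : ℝ) := by
    refine (mfderiv_prod_eq_add_apply hd).trans ?_
    exact (congrArg (_ + ·) (map_zero (mfderiv (𝓡 (d + 1)) J (f 0) p))).trans (add_zero _)
  exact congrArg (fun v ↦ (⟨f 0 p, v⟩ : TangentBundle J N)) h1.symm

section Flow

variable {A : Set M} {ψ : ℝ → M → M} {ξ : ∀ p : M, TangentSpace (𝓡 (d + 1)) p}

omit [IsManifold (𝓡 (d + 1)) ∞ M] in
lemma mfderiv_time_eq {p : M} (hψ0 : ψ 0 p = p)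
    (hξ : IsMIntegralCurve (I := 𝓡 (d + 1)) (fun t ↦ ψ t p) ξ) :
    (⟨ψ 0 p, mfderiv 𝓘(ℝ, ℝ) (𝓡 (d + 1)) (fun t ↦ ψ t p) 0 (1 : ℝ)⟩ :
      TangentBundle (𝓡 (d + 1)) M) = ⟨p, ξ p⟩ := by
  rw [(hξ 0).mfderiv]
  refine Eq.trans ?_ (congrArg (fun q ↦ (⟨q, ξ q⟩ : TangentBundle (𝓡 (d + 1)) M)) hψ0)
  exact congrArg (fun v ↦ (⟨ψ 0 p, v⟩ : TangentBundle (𝓡 (d + 1)) M)) (one_smul ℝ (ξ (ψ 0 p)))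

lemma contMDiffOn_generator (hA : IsOpen A) (hψ : IsFlowOn d A ψ)
    (hξ : ∀ p ∈ A, IsMIntegralCurve (I := 𝓡 (d + 1)) (fun t ↦ ψ t p) ξ) :
    ContMDiffOn (𝓡 (d + 1)) (𝓡 (d + 1)).tangent ∞
      (fun p ↦ (⟨p, ξ p⟩ : TangentBundle (𝓡 (d + 1)) M)) A :=
  (contMDiffOn_mfderiv_time hA hψ.smooth).congr fun p hp ↦
    (mfderiv_time_eq (hψ.zero p hp) (hξ p hp)).symm

lemma contMDiffOn_deriv_scaling (hA : IsOpen A) (hψ : IsFlowOn d A ψ) :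
    ContMDiffOn (𝓡 (d + 1)) 𝓘(ℝ, ℝ) ∞ (fun p ↦ deriv (fun t ↦ S.scaling (ψ t) p) 0) A := by
  have h := contMDiffOn_mfderiv_time hA (f := fun t p ↦ S.scaling (ψ t) p)
    (contMDiffOn_scaling (S := S) hA hψ.smooth)
  refine ((contMDiff_snd_tangentBundle_modelSpace ℝ 𝓘(ℝ, ℝ)).comp_contMDiffOn h).congr
    fun p hp ↦ ?_
  change deriv _ 0 = mfderiv 𝓘(ℝ, ℝ) 𝓘(ℝ, ℝ) (fun t ↦ S.scaling (ψ t) p) 0 (1 : ℝ)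
  rw [mfderiv_eq_fderiv]
  exact fderiv_apply_one_eq_deriv.symm

lemma hasDerivAt_scaling (hA : IsOpen A) (hψ : IsFlowOn d A ψ) {p : M} (hp : p ∈ A) :
    HasDerivAt (fun t ↦ S.scaling (ψ t) p) (deriv (fun t ↦ S.scaling (ψ t) p) 0) 0 := by
  have h1 : ContMDiffAt 𝓘(ℝ, ℝ) 𝓘(ℝ, ℝ) ∞ (fun t ↦ S.scaling (ψ t) p) 0 :=
    ((contMDiffOn_scaling (S := S) hA hψ.smooth).contMDiffAt
      ((isOpen_univ.prod hA).mem_nhds ⟨mem_univ 0, hp⟩)).comp (0 : ℝ)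
      (contMDiffAt_id.prodMk contMDiffAt_const)
  exact (h1.contDiffAt.differentiableAt (by simp)).hasDerivAt

/-- A flow in the chart at `p`. -/
def flowInChart (ψ : ℝ → M → M) (p : M) (z : ℝ × EuclideanSpace ℝ (Fin (d + 1))) :
    EuclideanSpace ℝ (Fin (d + 1)) :=
  extChartAt (𝓡 (d + 1)) p (ψ z.1 ((extChartAt (𝓡 (d + 1)) p).symm z.2))

lemma contDiffAt_flowInChart (hA : IsOpen A) (hψ : IsFlowOn d A ψ) {p : M} {t : ℝ}
    {y : EuclideanSpace ℝ (Fin (d + 1))} (hy : y ∈ (extChartAt (𝓡 (d + 1)) p).target)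
    (hyA : (extChartAt (𝓡 (d + 1)) p).symm y ∈ A)
    (hys : ψ t ((extChartAt (𝓡 (d + 1)) p).symm y) ∈ (extChartAt (𝓡 (d + 1)) p).source) :
    ContDiffAt ℝ ∞ (flowInChart ψ p) (t, y) := by
  set e := extChartAt (𝓡 (d + 1)) p with he
  rw [← contMDiffAt_iff_contDiffAt]
  have h1 : ContMDiffAt 𝓘(ℝ, ℝ × EuclideanSpace ℝ (Fin (d + 1))) (𝓡 (d + 1)) ∞
      (fun z : ℝ × EuclideanSpace ℝ (Fin (d + 1)) ↦ e.symm z.2) (t, y) :=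
    ((contMDiffOn_extChartAt_symm (n := ∞) p).contMDiffAt
      ((isOpen_extChartAt_target p).mem_nhds hy)).comp (t, y) contDiff_snd.contMDiff.contMDiffAt
  have h2 : ContMDiffAt 𝓘(ℝ, ℝ × EuclideanSpace ℝ (Fin (d + 1))) (𝓘(ℝ, ℝ).prod (𝓡 (d + 1))) ∞
      (fun z : ℝ × EuclideanSpace ℝ (Fin (d + 1)) ↦ (z.1, e.symm z.2)) (t, y) :=
    contDiff_fst.contMDiff.contMDiffAt.prodMk h1
  have h3 := (hψ.smooth.contMDiffAt
    ((isOpen_univ.prod hA).mem_nhds ⟨mem_univ t, hyA⟩)).comp (t, y) h2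
  exact ContMDiffAt.comp (t, y) (contMDiffAt_extChartAt' (by simpa [he] using hys)) h3

/-- The generator of a flow in the chart at `p`. -/
lemma vectorInChart_eq (hA : IsOpen A) (hψ : IsFlowOn d A ψ)
    (hξ : ∀ p ∈ A, IsMIntegralCurve (I := 𝓡 (d + 1)) (fun t ↦ ψ t p) ξ) {p : M}
    {y : EuclideanSpace ℝ (Fin (d + 1))} (hy : y ∈ (extChartAt (𝓡 (d + 1)) p).target)
    (hyA : (extChartAt (𝓡 (d + 1)) p).symm y ∈ A) :
    vectorInChart ξ p y = fderiv ℝ (flowInChart ψ p) (0, y) (1, 0) := by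
  set e := extChartAt (𝓡 (d + 1)) p with he
  have hq := hψ.zero _ hyA
  have hys : e.symm y ∈ e.source := e.map_target hy
  have h1 : HasDerivAt (fun t ↦ flowInChart ψ p (t, y))
      (fderiv ℝ (flowInChart ψ p) (0, y) (1, 0)) 0 :=
    ((contDiffAt_flowInChart hA hψ hy hyA (by rwa [hq])).differentiableAt
      (by simp)).hasFDerivAt.comp_hasDerivAt (f := fun t : ℝ ↦ (t, y)) (0 : ℝ)
        ((hasDerivAt_id (0 : ℝ)).prodMk (hasDerivAt_const _ _))
  have h2 : HasMFDerivAt (𝓡 (d + 1)) 𝓘(ℝ, EuclideanSpace ℝ (Fin (d + 1))) e (ψ 0 (e.symm y)) _ :=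
    (mdifferentiableAt_extChartAt (I := 𝓡 (d + 1)) (x := p)
      (by rw [hq]; simpa [he] using hys)).hasMFDerivAt
  let D : ℝ →L[ℝ] EuclideanSpace ℝ (Fin (d + 1)) :=
    (mfderiv (𝓡 (d + 1)) 𝓘(ℝ, EuclideanSpace ℝ (Fin (d + 1))) e (ψ 0 (e.symm y))).comp
      ((1 : ℝ →L[ℝ] ℝ).smulRight (ξ (ψ 0 (e.symm y))))
  have h3 : HasFDerivAt (fun t ↦ flowInChart ψ p (t, y)) D 0 :=
    (h2.comp 0 (hξ _ hyA 0)).hasFDerivAt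
  rw [← h3.hasDerivAt.unique h1]
  have key : ∀ q q', q' = q → (mfderiv (𝓡 (d + 1)) 𝓘(ℝ, EuclideanSpace ℝ (Fin (d + 1))) e q (ξ q) :
      EuclideanSpace ℝ (Fin (d + 1))) =
      mfderiv (𝓡 (d + 1)) 𝓘(ℝ, EuclideanSpace ℝ (Fin (d + 1))) e q' (ξ q') := by
    rintro q _ rfl; rfl
  refine (key _ _ hq).trans ?_
  exact (congrArg (mfderiv (𝓡 (d + 1)) 𝓘(ℝ, EuclideanSpace ℝ (Fin (d + 1))) e (ψ 0 (e.symm y)))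
    (one_smul ℝ (ξ (ψ 0 (e.symm y))))).symm

/-- The differential of a flow in the chart at `p`. -/
lemma fderiv_flowInChart (hA : IsOpen A) (hψ : IsFlowOn d A ψ) {p : M} (hp : p ∈ A) {t : ℝ}
    (ht : ψ t p ∈ (extChartAt (𝓡 (d + 1)) p).source) (v : TangentSpace (𝓡 (d + 1)) p) :
    fderiv ℝ (flowInChart ψ p) (t, extChartAt (𝓡 (d + 1)) p p)
      ((0 : ℝ), (v : EuclideanSpace ℝ (Fin (d + 1)))) =
      mfderiv (𝓡 (d + 1)) 𝓘(ℝ, EuclideanSpace ℝ (Fin (d + 1))) (extChartAt (𝓡 (d + 1)) p) (ψ t p)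
        (mfderiv (𝓡 (d + 1)) (𝓡 (d + 1)) (ψ t) p v) := by
  set e := extChartAt (𝓡 (d + 1)) p with he
  have hpp : e.symm (e p) = p := extChartAt_to_inv p
  have h1 : HasFDerivAt (fun y ↦ flowInChart ψ p (t, y)) ((fderiv ℝ (flowInChart ψ p) (t, e p)).comp
      (ContinuousLinearMap.inr ℝ ℝ _)) (e p) :=
    ((contDiffAt_flowInChart hA hψ (mem_extChartAt_target p) (by rwa [hpp])
      (by rwa [hpp])).differentiableAt (by simp)).hasFDerivAt.comp (e p)
        (hasFDerivAt_prodMk_right _ _)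
  have h2 : HasMFDerivAt (𝓡 (d + 1)) 𝓘(ℝ, EuclideanSpace ℝ (Fin (d + 1))) e (ψ t p) _ :=
    (mdifferentiableAt_extChartAt (I := 𝓡 (d + 1)) (x := p) (by simpa [he] using ht)).hasMFDerivAt
  have hψt : ContMDiffOn (𝓡 (d + 1)) (𝓡 (d + 1)) ∞ (ψ t) A := hψ.smooth.comp
    (contMDiffOn_const.prodMk contMDiffOn_id : ContMDiffOn (𝓡 (d + 1))
        (𝓘(ℝ, ℝ).prod (𝓡 (d + 1))) ∞ (fun p : M ↦ (t, p)) A) fun p hp ↦ ⟨mem_univ _, hp⟩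
  have h3 : HasMFDerivAt (𝓡 (d + 1)) (𝓡 (d + 1)) (ψ t) p _ :=
    ((hψt.contMDiffAt (hA.mem_nhds hp)).mdifferentiableAt (by simp)).hasMFDerivAt
  have h4 : HasMFDerivAt (𝓡 (d + 1)) 𝓘(ℝ, EuclideanSpace ℝ (Fin (d + 1))) e p _ :=
    (mdifferentiableAt_extChartAt (I := 𝓡 (d + 1)) (x := p) (by simp)).hasMFDerivAt
  have h5 := (h1.hasMFDerivAt.comp p h4).congr_of_eventuallyEq (f₁ := e ∘ ψ t)
    (Filter.mem_of_superset (extChartAt_source_mem_nhds (I := 𝓡 (d + 1)) p) fun q hq ↦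
      (congrArg (fun r ↦ e (ψ t r)) (e.left_inv hq)).symm)
  have : IsManifold (𝓡 (d + 1)) 1 M := .of_le (n := ∞) (by simp)
  have h6 := DFunLike.congr_fun (hasMFDerivAt_unique h5 (h2.comp p h3)) v
  refine Eq.trans ?_ h6
  refine congrArg (fun u ↦ fderiv ℝ (flowInChart ψ p) (t, e p) ((0 : ℝ), u)) ?_
  exact (DFunLike.congr_fun (mfderiv_extChartAt_self (I := 𝓡 (d + 1)) (x := p)) v).symm

/-- The generator of a flow that scales the metric is a conformal Killing field; its conformal
factor is the time derivative of the scaling. -/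
lemma conformalKillingOn_of_scaling (hA : IsOpen A) (hψ : IsFlowOn d A ψ)
    (hconf : ∀ t, ∀ p ∈ A, ∀ v w, S.metric (ψ t p) (mfderiv (𝓡 (d + 1)) (𝓡 (d + 1)) (ψ t) p v)
      (mfderiv (𝓡 (d + 1)) (𝓡 (d + 1)) (ψ t) p w) = S.scaling (ψ t) p * S.metric p v w)
    (hξ : ∀ p ∈ A, IsMIntegralCurve (I := 𝓡 (d + 1)) (fun t ↦ ψ t p) ξ) :
    S.ConformalKillingOn A ξ := by
  refine ⟨contMDiffOn_generator hA hψ hξ, fun p ↦ deriv (fun t ↦ S.scaling (ψ t) p) 0,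
    contMDiffOn_deriv_scaling hA hψ, fun p hp v w ↦ ?_⟩
  set e := extChartAt (𝓡 (d + 1)) p with he
  have hpp : e.symm (e p) = p := extChartAt_to_inv p
  have htgt : ∀ᶠ y in 𝓝 (e p), y ∈ e.target := extChartAt_target_mem_nhds p
  have hyA : ∀ᶠ y in 𝓝 (e p), e.symm y ∈ A :=
    (continuousAt_extChartAt_symm (I := 𝓡 (d + 1)) p).eventually_mem
      (by rw [← he, hpp]; exact hA.mem_nhds hp)
  have hsrc : ∀ᶠ t in 𝓝 (0 : ℝ), ψ t p ∈ e.source :=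
    (hξ p hp 0).continuousAt.eventually_mem (by
      rw [hψ.zero p hp]; exact extChartAt_source_mem_nhds p)
  have hG : S.metricInChart p (e p) v w = S.metric p v w := S.metric_chartVec_self p v w
  refine (covDeriv_add_covDeriv ξ p v w).trans (Eq.trans ?_ (congrArg (_ * ·) hG))
  refine lieDerivative_eq (F := flowInChart ψ p)
    (((S.contDiffOn_metricInChart p).contDiffAt (extChartAt_target_mem_nhds p)).differentiableAt
      (by simp))
    ((contDiffAt_flowInChart hA hψ (mem_extChartAt_target p) (by rwa [← he, hpp])
      (by rw [← he, hpp]; exact hsrc.self_of_nhds)).of_le ENat.LEInfty.out) ?_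
    (hasDerivAt_scaling hA hψ hp) ?_ ?_
  · filter_upwards [htgt, hyA] with y hy hyA
    simp only [flowInChart]
    rw [hψ.zero _ hyA]
    exact e.right_inv hy
  · filter_upwards [hsrc] with t ht
    have h1 : flowInChart ψ p (t, e p) = e (ψ t p) := by
      simp only [flowInChart, ← he, hpp]
    rw [← he, h1]
    have h2 := (metricInChart_mfderiv (S := S) ht _ _).trans (hconf t p hp v w)
    rw [← fderiv_flowInChart hA hψ hp ht v, ← fderiv_flowInChart hA hψ hp ht w] at h2
    exact h2.trans (congrArg (_ * ·) hG.symm)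
  · filter_upwards [htgt, hyA] with y hy hyA
    exact vectorInChart_eq hA hψ hξ hy hyA

end Flow

end Spacetime

/-! ### Geometric flows preserve spacelike separation -/

namespace ScalarField

variable {d : ℕ} {M : Type*} [TopologicalSpace M]
  [ChartedSpace (EuclideanSpace ℝ (Fin (d + 1))) M] [IsManifold (𝓡 (d + 1)) ∞ M]
  {H : Type*} [NormedAddCommGroup H] [InnerProductSpace ℂ H] [CompleteSpace H]

omit [IsManifold (𝓡 (d + 1)) ∞ M] in
lemma exists_op_conjugate {φ : ScalarField d M H} {U : unitary (H →L[ℂ] H)}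
    {f f' : SmearingFunction d M} (h : ConjugatesTo U (φ.op f) (φ.op f')) {u : H}
    (hu : u ∈ φ.dom) : ∃ hdom : (U : H →L[ℂ] H) u ∈ (φ.op f).domain,
      φ.op f ⟨(U : H →L[ℂ] H) u, hdom⟩ = (U : H →L[ℂ] H) (φ.op f' ⟨u, φ.dom_le f' hu⟩) := by
  obtain ⟨hdom, h⟩ := h
  refine ⟨(hdom u).1 (φ.dom_le f' hu), ?_⟩
  rw [h u (φ.dom_le f' hu)]
  have hU : (U : H →L[ℂ] H) * star (U : H →L[ℂ] H) = 1 := Unitary.mul_star_self_of_mem U.2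
  exact (DFunLike.congr_fun hU _).symm

omit [IsManifold (𝓡 (d + 1)) ∞ M] in
/-- If the conjugates of two field operators commute, then so do the field operators. The unitary
`U` need not preserve the common domain; but by Hermiticity the commutator on `dom` is minus the
adjoint of the commutator on `U dom`, which is dense. -/
lemma FieldsCommute.of_conjugatesTo {φ : ScalarField d M H} {U : unitary (H →L[ℂ] H)}
    {f f' h h' : SmearingFunction d M} (hf : ConjugatesTo U (φ.op f) (φ.op f'))
    (hh : ConjugatesTo U (φ.op h) (φ.op h')) (hc : φ.FieldsCommute f' h') :
    φ.FieldsCommute f h := by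
  intro v hv
  have hsurj : Function.Surjective (U : H →L[ℂ] H) := by
    have hU : (U : H →L[ℂ] H) * star (U : H →L[ℂ] H) = 1 := Unitary.mul_star_self_of_mem U.2
    exact fun y ↦ ⟨star (U : H →L[ℂ] H) y, DFunLike.congr_fun hU y⟩
  have hdense : Dense ((U : H →L[ℂ] H) '' (φ.dom : Set H)) :=
    hsurj.denseRange.dense_image (U : H →L[ℂ] H).continuous φ.dense_dom
  have key : ∀ {f f' h h' : SmearingFunction d M}, ConjugatesTo U (φ.op f) (φ.op f') →
      ConjugatesTo U (φ.op h) (φ.op h') → ∀ (u : H) (hu : u ∈ φ.dom),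
      ⟪(U : H →L[ℂ] H) u, φ.op f ⟨φ.op h ⟨v, φ.dom_le h hv⟩, φ.dom_le f (φ.op_mem h v hv)⟩⟫_ℂ =
        ⟪(U : H →L[ℂ] H) (φ.op h' ⟨φ.op f' ⟨u, φ.dom_le f' hu⟩,
          φ.dom_le h' (φ.op_mem f' u hu)⟩), v⟫_ℂ := by
    intro f f' h h' hf hh u hu
    obtain ⟨hd1, h1⟩ := exists_op_conjugate hf hu
    obtain ⟨hd2, h2⟩ := exists_op_conjugate hh (φ.op_mem f' u hu)
    rw [← h2]
    refine (φ.hermitian f ⟨_, hd1⟩ ⟨_, φ.dom_le f (φ.op_mem h v hv)⟩).symm.trans ?_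
    rw [h1]
    exact (φ.hermitian h ⟨_, hd2⟩ ⟨v, φ.dom_le h hv⟩).symm
  refine hdense.eq_of_inner_right ℂ ?_
  rintro _ ⟨u, hu, rfl⟩
  rw [key hf hh u hu, key hh hf u hu, hc u hu]

variable {φ : ScalarField d M H} {S : Spacetime d M} {A : Set M} {U : ℝ → unitary (H →L[ℂ] H)}
  {ψ : ℝ → M → M}

/-- A geometric unitary flow cannot move spacelike separated points to null separated points. By
microcausality the fields near the former commute, but the fields near the latter, which are
conjugate to them, do not all commute. -/
lemma not_nullSeparated_of_actsGeometricallyOn [T2Space M] (hS : S.GloballyHyperbolic)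
    (hmc : φ.Microcausality S) (hnc : φ.NullNoncommutation S) (hA : IsOpen A)
    (hψ : IsFlowOn d A ψ) (hact : ∀ t, φ.ActsGeometricallyOn (U t) A (ψ t)) {x y : M}
    (hx : x ∈ A) (hy : y ∈ A) (hxy : S.SpacelikeSeparated x y) (t : ℝ) :
    ¬ S.NullSeparated (ψ t x) (ψ t y) := by
  intro hnull
  obtain ⟨O₁, hO₁, O₂, hO₂, hO⟩ := mem_nhds_prod_iff.1
    ((Spacetime.isOpen_spacelikeSeparated hS).mem_nhds (show (x, y) ∈ _ from hxy))
  have hinv : ∀ z ∈ A, ψ (-t) (ψ t z) = z := fun z hz ↦ by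
    rw [← hψ.add _ _ z hz, neg_add_cancel, hψ.zero z hz]
  have hcont : ∀ z ∈ A, ContinuousAt (ψ (-t)) (ψ t z) := fun z hz ↦
    (hψ.smooth.continuousOn.continuousAt ((isOpen_univ.prod hA).mem_nhds
      ⟨mem_univ (-t), hψ.mapsTo t hz⟩)).comp (f := fun z ↦ (-t, z)) (by fun_prop)
  have hnhds : ∀ z ∈ A, ∀ O ∈ 𝓝 z, ∃ V ⊆ A, IsOpen V ∧ ψ t z ∈ V ∧ MapsTo (ψ (-t)) V O := by
    intro z hz O hO
    have h1 : ψ (-t) ⁻¹' O ∈ 𝓝 (ψ t z) := (hcont z hz).preimage_mem_nhds (by rwa [hinv z hz])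
    obtain ⟨V, hV, hVo, hzV⟩ := mem_nhds_iff.1
      (Filter.inter_mem h1 (hA.mem_nhds (hψ.mapsTo t hz)))
    exact ⟨V, fun w hw ↦ (hV hw).2, hVo, hzV, fun w hw ↦ (hV hw).1⟩
  obtain ⟨V₁, hV₁A, hV₁, hxV, hm₁⟩ := hnhds x hx O₁ hO₁
  obtain ⟨V₂, hV₂A, hV₂, hyV, hm₂⟩ := hnhds y hy O₂ hO₂
  obtain ⟨f, h, hf, hh, hfh⟩ := hnc _ _ hnull V₁ V₂ hV₁ hV₂ hxV hyV
  obtain ⟨f', hff', hf'⟩ := hact (-t) f (hf.trans hV₁A)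
  obtain ⟨h', hhh', hh'⟩ := hact (-t) h (hh.trans hV₂A)
  refine hfh (.of_conjugatesTo hff' hhh' (hmc f' h' ?_))
  rw [hf', hh']
  rintro _ ⟨a, ha, rfl⟩ _ ⟨b, hb, rfl⟩
  exact hO (show (ψ (-t) a, ψ (-t) b) ∈ O₁ ×ˢ O₂ from ⟨hm₁ (hf ha), hm₂ (hh hb)⟩)

/-- Geometric unitary flows preserve spacelike separation: otherwise the pair of moving points would
become null separated when it first ceases to be spacelike separated. -/
lemma spacelikeSeparated_flow [T2Space M] (hS : S.GloballyHyperbolic)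
    (hmc : φ.Microcausality S) (hnc : φ.NullNoncommutation S) (hA : IsOpen A)
    (hψ : IsFlowOn d A ψ) (hact : ∀ t, φ.ActsGeometricallyOn (U t) A (ψ t)) {x y : M}
    (hx : x ∈ A) (hy : y ∈ A) (hxy : S.SpacelikeSeparated x y) (t : ℝ) :
    S.SpacelikeSeparated (ψ t x) (ψ t y) := by
  have hcont : ∀ z ∈ A, Continuous fun t ↦ ψ t z := fun z hz ↦
    hψ.smooth.continuousOn.comp_continuous (f := fun t : ℝ ↦ (t, z)) (by fun_prop)
      fun t ↦ ⟨mem_univ t, hz⟩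
  have hpair : Continuous fun t ↦ (ψ t x, ψ t y) := (hcont x hx).prodMk (hcont y hy)
  have hopen : IsOpen {t | S.SpacelikeSeparated (ψ t x) (ψ t y)} :=
    (Spacetime.isOpen_spacelikeSeparated hS).preimage hpair
  have hclosed : IsClosed {t | S.SpacelikeSeparated (ψ t x) (ψ t y)} := by
    rw [isClosed_iff_frequently]
    intro s hs
    by_contra hns
    have hne : ψ s x ≠ ψ s y := by
      intro heq
      have h1 := congrArg (ψ (-s)) heq
      rw [← hψ.add _ _ x hx, ← hψ.add _ _ y hy, neg_add_cancel, hψ.zero x hx, hψ.zero y hy] at h1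
      exact hxy.ne h1
    exact not_nullSeparated_of_actsGeometricallyOn hS hmc hnc hA hψ hact hx hy hxy s
      (Spacetime.nullSeparated_of_frequently hne hns ((hpair.tendsto s).frequently hs))
  have huniv := IsClopen.eq_univ ⟨hclosed, hopen⟩
    ⟨0, show S.SpacelikeSeparated (ψ 0 x) (ψ 0 y) by rwa [hψ.zero x hx, hψ.zero y hy]⟩
  exact huniv.ge (mem_univ t)

/-- Geometric unitary flows are conformal, and generated by conformal Killing fields. -/
lemma conformal_of_actsGeometricallyOn [T2Space M] (hS : S.GloballyHyperbolic)
    (hmc : φ.Microcausality S) (hnc : φ.NullNoncommutation S) (hA : IsOpen A)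
    (hψ : IsFlowOn d A ψ) (hact : ∀ t, φ.ActsGeometricallyOn (U t) A (ψ t)) :
    (∀ t, ∀ x ∈ A, ∀ y ∈ A,
      S.SpacelikeSeparated x y ↔ S.SpacelikeSeparated (ψ t x) (ψ t y)) ∧
    (∀ t, S.ConformalOn A (ψ t)) ∧
    ∀ ξ : ∀ p : M, TangentSpace (𝓡 (d + 1)) p,
      (∀ p ∈ A, IsMIntegralCurve (I := 𝓡 (d + 1)) (fun t ↦ ψ t p) ξ) →
        S.ConformalKillingOn A ξ := by
  have hinv : ∀ t, ∀ z ∈ A, ψ (-t) (ψ t z) = z := fun t z hz ↦ by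
    rw [← hψ.add _ _ z hz, neg_add_cancel, hψ.zero z hz]
  have hinv' : ∀ t, ∀ z ∈ A, ψ t (ψ (-t) z) = z := fun t z hz ↦ by
    simpa using hinv (-t) z hz
  have hsep : ∀ t, ∀ x ∈ A, ∀ y ∈ A,
      S.SpacelikeSeparated x y ↔ S.SpacelikeSeparated (ψ t x) (ψ t y) := by
    refine fun t x hx y hy ↦ ⟨fun h ↦ spacelikeSeparated_flow hS hmc hnc hA hψ hact hx hy h t,
      fun h ↦ ?_⟩
    have h1 := spacelikeSeparated_flow hS hmc hnc hA hψ hact (hψ.mapsTo t hx) (hψ.mapsTo t hy) h (-t)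
    rwa [hinv t x hx, hinv t y hy] at h1
  have hsmooth : ∀ t, ContMDiffOn (𝓡 (d + 1)) (𝓡 (d + 1)) ∞ (ψ t) A := fun t ↦ hψ.smooth.comp
    (contMDiffOn_const.prodMk contMDiffOn_id : ContMDiffOn (𝓡 (d + 1))
      (𝓘(ℝ, ℝ).prod (𝓡 (d + 1))) ∞ (fun p : M ↦ (t, p)) A) fun p hp ↦ ⟨mem_univ _, hp⟩
  have hscal := fun t p hp ↦ Spacetime.metric_mfderiv_eq_scaling_of_forall hS.1 hA (hsmooth t)
    (hsmooth (-t)) (hψ.mapsTo t) (hinv t) (hψ.mapsTo (-t)) (hinv' t) (hsep t) (p := p) hp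
  exact ⟨hsep, fun t ↦ Spacetime.conformalOn_of_scaling hA (hsmooth t) (hscal t),
    fun ξ hξ ↦ Spacetime.conformalKillingOn_of_scaling hA hψ (fun t p hp ↦ (hscal t p hp).2) hξ⟩

end ScalarField

end

theorem mainTheorem2 {d : ℕ} {M : Type*} [TopologicalSpace M]
    [ChartedSpace (EuclideanSpace ℝ (Fin (d + 1))) M] [IsManifold (𝓡 (d + 1)) ∞ M]
    [T2Space M] [SecondCountableTopology M]
    {H : Type*} [NormedAddCommGroup H] [InnerProductSpace ℂ H] [CompleteSpace H]
    (S : Spacetime d M) (hS : S.GloballyHyperbolic) :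
    -- a diffeomorphism preserving spacelike separation is conformal
    (∀ ψ : M ≃ₘ^∞⟮𝓡 (d + 1), 𝓡 (d + 1)⟯ M,
      (∀ x y, S.SpacelikeSeparated x y ↔ S.SpacelikeSeparated (ψ x) (ψ y)) →
        S.ConformalOn univ ψ) ∧
    ∀ φ : ScalarField d M H, φ.Microcausality S → φ.NullNoncommutation S →
      -- geometric unitary flows (on all of `M`, or in an open region)
      (∀ (A : Set M) (U : ℝ → unitary (H →L[ℂ] H)) (ψ : ℝ → M → M),
        IsOpen A → IsUnitaryGroup U → IsFlowOn d A ψ →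
        (∀ t, φ.ActsGeometricallyOn (U t) A (ψ t)) →
          (∀ t, ∀ x ∈ A, ∀ y ∈ A,
            S.SpacelikeSeparated x y ↔ S.SpacelikeSeparated (ψ t x) (ψ t y)) ∧
          (∀ t, S.ConformalOn A (ψ t)) ∧
          ∀ ξ : ∀ p : M, TangentSpace (𝓡 (d + 1)) p,
            (∀ p ∈ A, IsMIntegralCurve (I := 𝓡 (d + 1)) (fun t ↦ ψ t p) ξ) →
              S.ConformalKillingOn A ξ) ∧
      -- geometric modular flow
      (∀ (A : Set M) (Ψ : H) (U : ℝ → unitary (H →L[ℂ] H)) (ψ : ℝ → M → M)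
        (ξ : ∀ p : M, TangentSpace (𝓡 (d + 1)) p),
        IsOpen A → IsCyclicSeparating (φ.localAlgebra A) Ψ →
        IsModularFlow (φ.localAlgebra A) Ψ U → IsFlowOn d A ψ →
        (∀ p ∈ A, IsMIntegralCurve (I := 𝓡 (d + 1)) (fun t ↦ ψ t p) ξ) →
        (∀ t, φ.ActsGeometricallyOn (U t) A (ψ t)) →
          (∀ t, S.ConformalOn A (ψ t)) ∧ S.ConformalKillingOn A ξ) := by
  refine ⟨fun ψ hψ ↦ ?_, fun φ hmc hnc ↦ ⟨fun A U ψ hA _ hψ hact ↦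
    φ.conformal_of_actsGeometricallyOn hS hmc hnc hA hψ hact,
    fun A Ψ U ψ ξ hA _ _ hψ hξ hact ↦ ?_⟩⟩
  · refine Spacetime.conformalOn_of_scaling isOpen_univ ψ.contMDiff.contMDiffOn fun p hp ↦
      Spacetime.metric_mfderiv_eq_scaling_of_forall hS.1 isOpen_univ ψ.contMDiff.contMDiffOn
        ψ.symm.contMDiff.contMDiffOn (mapsTo_univ _ _) (fun x _ ↦ ψ.symm_apply_apply x)
        (mapsTo_univ _ _) (fun x _ ↦ ψ.apply_symm_apply x) (fun x _ y _ ↦ hψ x y) hp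
  · have h := φ.conformal_of_actsGeometricallyOn hS hmc hnc hA hψ hact
    exact ⟨h.2.1, h.2.2 ξ hξ⟩
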